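/- **Theorem (complex Positivstellensatz).** Notation: $\langle\cdot|\cdot\rangle$ is the standard inner product, conjugate-linear in the first argument; $\vee^n\mathbb C^d\subseteq(\mathbb C^d)^{\otimes n}$ is the symmetric subspace, $P^{(n,d)}_{sym}$ the orthogonal projection onto it, and $d[n]=\binom{d+n-1}{n}$ its dimension. For a Hermitian operator $W$ on $\vee^k\mathbb C^d\otimes\mathbb C^D$ put $$p_W(x,y)=\langle x^{\otimes k}\otimes y|\,W\,|x^{\otimes k}\otimes y\rangle\qquad(x\in\mathbb C^d,\ y\in\mathbb C^D),$$ and let $m(W)$ and $M(W)$ be the minimum and the maximum of $p_W(x,y)$ over $\|x\|=\|y\|=1$. For $t\le k$ let $\operatorname{tr}_{k\to t}:\mathcal B(\vee^k\mathbb C^d)\to\mathcal B(\vee^t\mathbb C^d)$ be the partial trace over $k-t$ tensor factors and let $\operatorname{tr}^*_{t\to k}(X)=P^{(k,d)}_{sym}(X\otimes I^{\otimes(k-t)})P^{(k,d)}_{sym}$ be its adjoint. A complex spherical $n$-design is a measure $\mathrm d\phi$ on the unit sphere $\mathcal S^{d-1}$ of $\mathbb C^d$ with $d[n]\int_{\mathcal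 S^{d-1}}|\phi\rangle\langle\phi|^{\otimes n}\,\mathrm d\phi=P^{(n,d)}_{sym}$. Let $W$ be a Hermitian operator on $\vee^k\mathbb C^d\otimes\mathbb C^D$ with $m(W)>0$, and let $n\ge k$ be an integer such that $$n\ \ge\ \frac{dk(2k-1)}{\ln\!\left(1+\frac{m(W)}{M(W)}\right)}-d-k+1,$$ or, in the case $k=1$, only such that $n\ge d\,\frac{M(W)}{m(W)}-d$. Set $$\tilde W=d[n+k]\sum_{t=0}^{k}q(n,k,t)\,\bigl((\operatorname{tr}^*_{t\to k}\circ\operatorname{tr}_{k\to t})\otimes\operatorname{id}_D\bigr)(W),\qquad q(n,k,t)=(-1)^{t+k}\,\frac{\binom{n+t}{t}\binom kt}{\binom nk}\,\frac{d[n+t]}{d[n+k]}.$$ Then $\tilde W$ is a Hermitian operator on $\vee^k\mathbb C^d\otimes\mathbb C^D$, and $p_{\tilde W}(\phi,y)\ge0$ for all $\phi\in\mathbb C^d$ and $y\in\mathbb C^D$. Moreover, for every complex spherical $(n+k)$-design $\mathrm d\phi$ and all $x\in\mathbb C^d$, $y\in\mathbb C^D$, $$\|x\|^{2(n-k)}\,p_W(x,y)=\int_{\mathcal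 S^{d-1}}p_{\tilde W}(\phi,y)\,|\langle\phi|x\rangle|^{2n}\,\mathrm d\phi .$$ In particular, $\|x\|^{2(n-k)}p_W(x,y)$ is a sum of squares: there are finitely many vectors $\phi_1,\dots,\phi_N\in\mathbb C^d$ and $w_1,\dots,w_N\in\mathbb C^D$ such that, for all $x\in\mathbb C^d$ and $y\in\mathbb C^D$, $$\|x\|^{2(n-k)}\,p_W(x,y)=\sum_{j=1}^N\bigl|\langle\phi_j|x\rangle^n\,\langle w_j|y\rangle\bigr|^2 .$$ -/

import Mathlib

open MeasureTheory

namespace PSSC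

noncomputable section

/-- The standard inner product `⟨x|y⟩ = ∑ᵢ conj(xᵢ) yᵢ` of `ℂ^ι`. The instance is named because
instance search also finds one that views `ℂ^ι` as a Hilbert C⋆-module. -/
abbrev braket {ι : Type} [Fintype ι] (x y : EuclideanSpace ℂ ι) : ℂ :=
  @inner ℂ (EuclideanSpace ℂ ι) InnerProductSpace.toInner x y

/-- `d[n]`, the dimension `binom (d+n-1) n` of the symmetric subspace `∨ⁿ ℂᵈ`. -/
def dimSym (d n : ℕ) : ℕ := (d + n - 1).choose n

/-! ### Tensor powers, in coordinates

`(ℂᵈ)^{⊗n}` is the Hilbert space with orthonormal basis indexed by the multi-indices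
`Fin n → Fin d`, and `(ℂᵈ)^{⊗k} ⊗ ℂᴰ` the one indexed by `(Fin k → Fin d) × Fin D`. -/

/-- `(ℂᵈ)^{⊗n}`. -/
abbrev TPow (d n : ℕ) : Type := EuclideanSpace ℂ (Fin n → Fin d)

/-- `(ℂᵈ)^{⊗k} ⊗ ℂᴰ`. -/
abbrev TPowD (d k D : ℕ) : Type := EuclideanSpace ℂ ((Fin k → Fin d) × Fin D)

/-- The product vector `x^{⊗n}`. -/
def tpow {d : ℕ} (n : ℕ) (x : EuclideanSpace ℂ (Fin d)) : TPow d n :=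
  WithLp.toLp 2 fun i => ∏ s, x (i s)

/-- The symmetric subspace `∨ⁿ ℂᵈ` of `(ℂᵈ)^{⊗n}`: the vectors that are invariant under all
permutations of the `n` tensor factors. -/
def symSubspace (d n : ℕ) : Submodule ℂ (TPow d n) where
  carrier := {v | ∀ (σ : Equiv.Perm (Fin n)) (i : Fin n → Fin d), v (i ∘ σ) = v i}
  add_mem' := by
    intro v w hv hw σ i
    simp [hv σ i, hw σ i]
  zero_mem' := by
    intro σ i
    simp
  smul_mem' := by
    intro c v hv σ i
    simp [hv σ i]

/-- `∨ᵏ ℂᵈ ⊗ ℂᴰ` as a subspace of `(ℂᵈ)^{⊗k} ⊗ ℂᴰ`: the vectors that are invariant under all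
permutations of the `k` tensor factors `ℂᵈ`. -/
def symD (d k D : ℕ) : Submodule ℂ (TPowD d k D) where
  carrier := {v | ∀ (σ : Equiv.Perm (Fin k)) (i : Fin k → Fin d) (a : Fin D),
    v (i ∘ σ, a) = v (i, a)}
  add_mem' := by
    intro v w hv hw σ i a
    simp [hv σ i a, hw σ i a]
  zero_mem' := by
    intro σ i a
    simp
  smul_mem' := by
    intro c v hv σ i a
    simp [hv σ i a]

/-- `ℬ(∨ᵏ ℂᵈ ⊗ ℂᴰ)`, the linear operators on `∨ᵏ ℂᵈ ⊗ ℂᴰ`. -/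
abbrev SymOp (d k D : ℕ) : Type := symD d k D →ₗ[ℂ] symD d k D

/-- The operator `W` on `∨ᵏ ℂᵈ ⊗ ℂᴰ` is Hermitian. -/
abbrev SymOp.IsHermitian {d k D : ℕ} (W : SymOp d k D) : Prop :=
  LinearMap.IsSymmetric (𝕜 := ℂ) (E := symD d k D) W

/-- The vector `x^{⊗k} ⊗ y` of `∨ᵏ ℂᵈ ⊗ ℂᴰ`. -/
def prodVec {d D : ℕ} (k : ℕ) (x : EuclideanSpace ℂ (Fin d)) (y : EuclideanSpace ℂ (Fin D)) :
    symD d k D :=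
  ⟨WithLp.toLp 2 fun p => (∏ s, x (p.1 s)) * y p.2, by
    intro σ i a
    simp only [Function.comp_apply]
    rw [Equiv.prod_comp σ (fun s => x (i s))]⟩

/-- The form `p_W(x, y) = ⟨x^{⊗k} ⊗ y| W |x^{⊗k} ⊗ y⟩`; this inner product is real if `W` is
Hermitian, and the definition takes its real part in order to have real values. -/
def form {d k D : ℕ} (W : SymOp d k D) (x : EuclideanSpace ℂ (Fin d))
    (y : EuclideanSpace ℂ (Fin D)) : ℝ :=
  (braket (prodVec k x y : TPowD d k D) (W (prodVec k x y) : TPowD d k D)).re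

/-- For Hermitian `W`, taking the real part in `form` loses nothing. -/
theorem coe_form {d k D : ℕ} {W : SymOp d k D} (hW : W.IsHermitian)
    (x : EuclideanSpace ℂ (Fin d)) (y : EuclideanSpace ℂ (Fin D)) :
    ((form W x y : ℝ) : ℂ) =
      braket (prodVec k x y : TPowD d k D) (W (prodVec k x y) : TPowD d k D) :=
  hW.coe_re_inner_self_apply (prodVec k x y)

/-- The set of values of `p_W` on the product of the two unit spheres. -/
def formValues {d k D : ℕ} (W : SymOp d k D) : Set ℝ :=
  {r | ∃ x y, ‖x‖ = 1 ∧ ‖y‖ = 1 ∧ form W x y = r}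

/-- `m(W)`, the minimum of `p_W` on the product of the two unit spheres. -/
def formMin {d k D : ℕ} (W : SymOp d k D) : ℝ := sInf (formValues W)

/-- `M(W)`, the maximum of `p_W` on the product of the two unit spheres. -/
def formMax {d k D : ℕ} (W : SymOp d k D) : ℝ := sSup (formValues W)

theorem continuous_prodVec {d D : ℕ} (k : ℕ) :
    Continuous fun z : EuclideanSpace ℂ (Fin d) × EuclideanSpace ℂ (Fin D) =>
      prodVec k z.1 z.2 := by
  unfold prodVec
  fun_prop

theorem isCompact_formValues {d k D : ℕ} (W : SymOp d k D) : IsCompact (formValues W) := by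
  have hc : Continuous fun z : EuclideanSpace ℂ (Fin d) × EuclideanSpace ℂ (Fin D) =>
      form W z.1 z.2 := by
    have hW : Continuous fun v : symD d k D => W v := W.continuous_of_finiteDimensional
    have hv := continuous_prodVec (d := d) (D := D) k
    exact Complex.continuous_re.comp 
      ((continuous_subtype_val.comp hv).inner (continuous_subtype_val.comp (hW.comp hv)))
  have := ((isCompact_sphere (0 : EuclideanSpace ℂ (Fin d)) 1).prod
    (isCompact_sphere (0 : EuclideanSpace ℂ (Fin D)) 1)).image hc
  convert this using 1
  ext r
  simp [formValues]

/-- If both spheres are nonempty, then `m(W)` is a minimum and `M(W)` is a maximum. -/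
theorem formMin_formMax_attained {d k D : ℕ} (hd : 0 < d) (hD : 0 < D) (W : SymOp d k D) :
    IsLeast (formValues W) (formMin W) ∧ IsGreatest (formValues W) (formMax W) := by
  have hne : (formValues W).Nonempty :=
    ⟨_, EuclideanSpace.single ⟨0, hd⟩ 1, EuclideanSpace.single ⟨0, hD⟩ 1, by simp, by simp, rfl⟩
  exact ⟨(isCompact_formValues W).isLeast_sInf hne, (isCompact_formValues W).isGreatest_sSup hne⟩

/-- The matrix of an operator on `∨ᵏ ℂᵈ ⊗ ℂᴰ`, extended by `0` on the orthogonal complement to an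
operator on `(ℂᵈ)^{⊗k} ⊗ ℂᴰ`. -/
def ext {d k D : ℕ} (W : SymOp d k D) :
    Matrix ((Fin k → Fin d) × Fin D) ((Fin k → Fin d) × Fin D) ℂ :=
  Matrix.of fun p r =>
    (W ((symD d k D).orthogonalProjectionOnto (EuclideanSpace.single r 1)) : TPowD d k D) p

/-- The compression `P A P` of an operator `A` on `(ℂᵈ)^{⊗k} ⊗ ℂᴰ` to `∨ᵏ ℂᵈ ⊗ ℂᴰ`, where `P` is
the orthogonal projection. -/
def compress {d k D : ℕ} (A : Matrix ((Fin k → Fin d) × Fin D) ((Fin k → Fin d) × Fin D) ℂ) :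
    SymOp d k D :=
  (symD d k D).orthogonalProjectionOnto.toLinearMap ∘ₗ Matrix.toEuclideanLin A ∘ₗ
    (symD d k D).subtype

/-- The multi-index of length `k` whose first `t` entries are `i` and whose other entries
are `l`. -/
def joinIdx {d k t : ℕ} (i : Fin t → Fin d) (l : Fin (k - t) → Fin d) : Fin k → Fin d :=
  fun u => if h : (u : ℕ) < t then i ⟨u, h⟩ else l ⟨u - t, by omega⟩

/-- `tr_{k → t} ⊗ id_D` for `t ≤ k`: the partial trace that erases the last `k - t` of the `k`
tensor factors `ℂᵈ`. -/
def trDown {d k D : ℕ} (t : ℕ) (W : SymOp d k D) : SymOp d t D :=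
  compress (Matrix.of fun p r =>
    ∑ l : Fin (k - t) → Fin d, ext W (joinIdx p.1 l, p.2) (joinIdx r.1 l, r.2))

/-- `tr*_{t → k} ⊗ id_D` for `t ≤ k`, that is `X ↦ P (X ⊗ I^{⊗(k-t)}) P`, where the identity acts
on the last `k - t` of the `k` tensor factors `ℂᵈ`. -/
def trUp {d t D : ℕ} (k : ℕ) (htk : t ≤ k) (X : SymOp d t D) : SymOp d k D :=
  compress (Matrix.of fun p r =>
    if ∀ u : Fin k, t ≤ (u : ℕ) → p.1 u = r.1 u then
      ext X (fun s => p.1 (Fin.castLE htk s), p.2) (fun s => r.1 (Fin.castLE htk s), r.2)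
    else 0)

/-- The coefficient
`q(n,k,t) = (-1)^{t+k} binom(n+t,t) binom(k,t) / binom(n,k) * d[n+t] / d[n+k]`. -/
def coeffQ (d n k t : ℕ) : ℝ :=
  (-1) ^ (t + k) * (((n + t).choose t : ℝ) * (k.choose t : ℝ) / (n.choose k : ℝ)) *
    ((dimSym d (n + t) : ℝ) / (dimSym d (n + k) : ℝ))

/-- The operator
`W̃ = d[n+k] ∑_{t=0}^{k} q(n,k,t) ((tr*_{t → k} ∘ tr_{k → t}) ⊗ id_D)(W)`. -/
def tildeOp {d k D : ℕ} (n : ℕ) (W : SymOp d k D) : SymOp d k D :=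
  (dimSym d (n + k) : ℂ) •
    ∑ t : Fin (k + 1), ((coeffQ d n k t : ℝ) : ℂ) •
      trUp k (Nat.lt_succ_iff.mp t.isLt) (trDown (t : ℕ) W)

/-- A measure `μ` on the unit sphere of `ℂᵈ` is a complex spherical `n`-design if
`d[n] ∫ |φ⟩⟨φ|^{⊗n} dμ(φ)` is the orthogonal projection of `(ℂᵈ)^{⊗n}` onto the symmetric subspace.
(Taking traces shows that such a measure has total mass `1`; finiteness is spelled out so that the
Bochner integral is a true integral.) -/
structure IsSphericalDesign (d n : ℕ)
    (μ : Measure (Metric.sphere (0 : EuclideanSpace ℂ (Fin d)) 1)) : Prop where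
  finite : IsFiniteMeasure μ
  integral_eq :
    (dimSym d n : ℂ) •
        ∫ φ, InnerProductSpace.rankOne ℂ (tpow n (φ : EuclideanSpace ℂ (Fin d)))
          (tpow n (φ : EuclideanSpace ℂ (Fin d))) ∂μ =
      (symSubspace d n).starProjection

end

end PSSC

open PSSC

/-!
The integral formula. A form is determined by its values on product vectors, because symmetric
tensors are determined by their polynomials (`symmetric_eq_zero_of_forall_sum_eq_zero`), so linear
identities between operators need only be checked on `|b^{⊗k} ⊗ w'⟩⟨a^{⊗k} ⊗ w|`
(`eq_of_eq_on_pureOp`). Polarizing the moment identity `d[m] ∫ ⟨u|φ⟩^m ⟨φ|v⟩^m dφ = ⟨u|v⟩^m` of a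
design gives its mixed moments, and hence the integral of `p_V(φ, y) |⟨φ|x⟩|^{2n}` as a combination
of the forms of the partial traces of `V` (`HasMoments.integral_cform`). Since a design of degree
`n + k` is one of all lower degrees, this applies to each `tr_{k → t} W`, and binomial inversion
shows that the coefficients `q(n,k,t)` are chosen so that only `p_W` survives.

Positivity. Write `p_{W̃}` as an alternating sum of the forms of `tr_{k → t} W`, and compare the
terms `t < k` with the term `t = k`, which is `p_W` up to a positive factor. The tool is a
Bernstein inequality: tracing out one of `k` factors multiplies the maximum of the absolute value of
a form by at most `d (2k-1) / k` (`abs_form_trDown_le`). Indeed, averaging the form over the circles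
`√(1-s) x + √s e^{iθ} u` gives a polynomial `∑ c_j s^j (1-s)^{k-j}` on `[0, 1]`; the partial trace
is the sum of `c_1 / k²` over an orthonormal basis of vectors `u` that contains `x`, and for `u ⊥ x`
`|c_1|` is largest for the Chebyshev polynomial `T_k(1-2s)` (`abs_coeff_one_le`). Iterating this, the terms `t < k` are bounded
by those of an exponential series, whose sum the lower bound on `n` makes at most `m(W) / M(W)`.

Sums of squares. A finite cubature formula with the moments of an `(n+k)`-design exists
(`exists_finite_design`): Gaussian integrals have the right moments, radial projection moves them to
the sphere, and Carathéodory's theorem makes the integral finite. In the integral formula for it,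
each `p_{W̃}(φ, ·)` is a nonnegative Hermitian form on `ℂᴰ`, so it is a sum of squares of linear
forms (`exists_form_eq_sum_norm_sq`).
-/

open scoped NNReal

namespace PSSC

noncomputable section

/-! ### Product vectors and their span -/

/-- The diagonal value `⟨x^{⊗k} ⊗ y| W |x^{⊗k} ⊗ y⟩` as a complex number; it is linear in `W`, also
for operators that are not Hermitian. -/
def cform {d k D : ℕ} (x : EuclideanSpace ℂ (Fin d)) (y : EuclideanSpace ℂ (Fin D)) :
    SymOp d k D →ₗ[ℂ] ℂ where
  toFun W := braket (prodVec k x y : TPowD d k D) (W (prodVec k x y) : TPowD d k D)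
  map_add' V W := by simp [inner_add_right]
  map_smul' c W := by simp [inner_smul_right]

theorem cform_eq_form {d k D : ℕ} {W : SymOp d k D} (hW : W.IsHermitian)
    (x : EuclideanSpace ℂ (Fin d)) (y : EuclideanSpace ℂ (Fin D)) :
    cform x y W = (form W x y : ℂ) := (coe_form hW x y).symm

theorem braket_eq_sum {ι : Type} [Fintype ι] (x y : EuclideanSpace ℂ ι) :
    braket x y = ∑ i, star (x i) * y i := by
  simp [braket, PiLp.inner_apply, mul_comm]

theorem star_braket {ι : Type} [Fintype ι] (x y : EuclideanSpace ℂ ι) :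
    star (braket x y) = braket y x := by
  simp only [braket_eq_sum, star_sum, star_mul', star_star, mul_comm]

theorem braket_self {ι : Type} [Fintype ι] (x : EuclideanSpace ℂ ι) :
    braket x x = (‖x‖ : ℂ) ^ 2 :=
  inner_self_eq_norm_sq_to_K (𝕜 := ℂ) (E := EuclideanSpace ℂ ι) x

theorem braket_prodVec {d k D : ℕ} (a b : EuclideanSpace ℂ (Fin d))
    (w y : EuclideanSpace ℂ (Fin D)) :
    braket (prodVec k a w : TPowD d k D) (prodVec k b y : TPowD d k D) =
      braket a b ^ k * braket w y := by
  simp only [braket_eq_sum, Fintype.sum_pow, Fintype.sum_mul_sum, prodVec, Fintype.sum_prod_type]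
  refine Finset.sum_congr rfl fun i _ => Finset.sum_congr rfl fun j _ => ?_
  simp only [star_mul', star_prod, Finset.prod_mul_distrib]
  ring

/-- Two multi-indices in which every value occurs equally often are permutations of each other. -/
theorem exists_perm_of_counts_eq {d k : ℕ} {I J : Fin k → Fin d}
    (h : ∑ s, Finsupp.single (I s) (1 : ℕ) = ∑ s, Finsupp.single (J s) (1 : ℕ)) :
    ∃ σ : Equiv.Perm (Fin k), J ∘ σ = I := by
  have hc : ∀ c, Fintype.card {s // I s = c} = Fintype.card {s // J s = c} := by
    intro c
    have := DFunLike.congr_fun h c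
    simpa [Finsupp.finsetSum_apply, Finsupp.single_apply, Fintype.card_subtype] using this
  refine ⟨Equiv.ofFiberEquiv fun c => Fintype.equivOfCardEq (hc c), ?_⟩
  funext s
  exact Equiv.ofFiberEquiv_map _ s

/-- A symmetric tensor whose associated homogeneous polynomial vanishes identically is zero. -/
theorem symmetric_eq_zero_of_forall_sum_eq_zero {d k : ℕ} (v : (Fin k → Fin d) → ℂ)
    (hv : ∀ (σ : Equiv.Perm (Fin k)) (i : Fin k → Fin d), v (i ∘ σ) = v i)
    (h : ∀ x : Fin d → ℂ, ∑ I, (∏ s, x (I s)) * v I = 0) : v = 0 := by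
  classical
  set P : MvPolynomial (Fin d) ℂ :=
    ∑ I : Fin k → Fin d, MvPolynomial.monomial (∑ s, Finsupp.single (I s) 1) (v I) with hP
  have hP0 : P = 0 := by
    apply MvPolynomial.funext
    intro x
    rw [hP, map_sum, map_zero, ← h x]
    refine Finset.sum_congr rfl fun I _ => ?_
    have : MvPolynomial.monomial (∑ s, Finsupp.single (I s) 1) (v I) =
        MvPolynomial.C (v I) * ∏ s, (MvPolynomial.X (I s) : MvPolynomial (Fin d) ℂ) := by
      simp only [MvPolynomial.X]
      rw [← MvPolynomial.monomial_sum_one, MvPolynomial.C_mul_monomial, mul_one]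
    rw [this]
    simp [mul_comm]
  funext I
  have hI := congrArg (MvPolynomial.coeff (∑ s, Finsupp.single (I s) 1)) hP0
  simp only [hP, MvPolynomial.coeff_sum, MvPolynomial.coeff_monomial, MvPolynomial.coeff_zero] at hI
  -- all the terms with the same monomial as `I` carry the same coefficient `v I`
  have h2 : ∀ J : Fin k → Fin d,
      (if ∑ s, Finsupp.single (J s) 1 = ∑ s, Finsupp.single (I s) 1 then v J else 0) =
      (if ∑ s, Finsupp.single (J s) 1 = ∑ s, Finsupp.single (I s) (1 : ℕ) then 1 else 0) * v I := by
    intro J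
    split_ifs with hJ
    · obtain ⟨σ, hσ⟩ := exists_perm_of_counts_eq hJ
      rw [← hσ, hv, one_mul]
    · simp
  rw [Finset.sum_congr rfl fun J _ => h2 J, ← Finset.sum_mul, Finset.sum_boole] at hI
  rcases mul_eq_zero.1 hI with h0 | h0
  · exfalso
    rw [Nat.cast_eq_zero, Finset.card_eq_zero] at h0
    exact Finset.notMem_empty I (h0 ▸ by simp)
  · exact h0

/-- The product vectors `x^{⊗k} ⊗ y` span `∨ᵏ ℂᵈ ⊗ ℂᴰ`. -/
theorem span_prodVec (d k D : ℕ) :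
    Submodule.span ℂ (Set.range fun z : EuclideanSpace ℂ (Fin d) × EuclideanSpace ℂ (Fin D) =>
      prodVec k z.1 z.2) = ⊤ := by
  rw [← Submodule.orthogonal_eq_bot_iff (𝕜 := ℂ) (E := symD d k D), Submodule.eq_bot_iff]
  intro v hv
  rw [Submodule.mem_orthogonal] at hv
  have h : ∀ x y, braket (prodVec k x y : TPowD d k D) (v : TPowD d k D) = 0 := fun x y =>
    hv _ (Submodule.subset_span ⟨(x, y), rfl⟩)
  ext ⟨I, a⟩
  have := symmetric_eq_zero_of_forall_sum_eq_zero (fun I => (v : TPowD d k D) (I, a))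
    (fun σ i => v.2 σ i a) ?_
  · exact congrFun this I
  · intro x
    have h1 := h (WithLp.toLp 2 (star x)) (EuclideanSpace.single a 1)
    rw [braket_eq_sum, Fintype.sum_prod_type] at h1
    rw [← h1]
    refine Finset.sum_congr rfl fun I _ => ?_
    rw [Finset.sum_eq_single a]
    · simp [prodVec]
    · intro b _ hb
      simp [prodVec, hb]
    · simp

/-- The operator `|q⟩⟨p|` on `∨ᵏ ℂᵈ ⊗ ℂᴰ`. -/
def rankOneOp {d k D : ℕ} (p q : symD d k D) : SymOp d k D where
  toFun v := braket (p : TPowD d k D) (v : TPowD d k D) • q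
  map_add' v v' := by simp [inner_add_right, add_smul]
  map_smul' c v := by simp [inner_smul_right, mul_smul]

theorem rankOneOp_apply {d k D : ℕ} (p q v : symD d k D) :
    rankOneOp p q v = braket (p : TPowD d k D) (v : TPowD d k D) • q := rfl

/-- The operator `|b^{⊗k} ⊗ w'⟩⟨a^{⊗k} ⊗ w|`. -/
def pureOp {d D : ℕ} (k : ℕ) (a b : EuclideanSpace ℂ (Fin d)) (w w' : EuclideanSpace ℂ (Fin D)) :
    SymOp d k D :=
  rankOneOp (prodVec k a w) (prodVec k b w')

/-- The operators `|b^{⊗k} ⊗ w'⟩⟨a^{⊗k} ⊗ w|` span all the operators. -/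
theorem span_pureOp (d k D : ℕ) (W : SymOp d k D) :
    W ∈ Submodule.span ℂ (Set.range fun z : (EuclideanSpace ℂ (Fin d) × EuclideanSpace ℂ (Fin d)) ×
      (EuclideanSpace ℂ (Fin D) × EuclideanSpace ℂ (Fin D)) =>
        pureOp k z.1.1 z.1.2 z.2.1 z.2.2) := by
  set S := Submodule.span ℂ (Set.range fun z : (EuclideanSpace ℂ (Fin d) ×
    EuclideanSpace ℂ (Fin d)) × (EuclideanSpace ℂ (Fin D) × EuclideanSpace ℂ (Fin D)) =>
        pureOp k z.1.1 z.1.2 z.2.1 z.2.2) with hS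
  have key : ∀ p q : symD d k D, rankOneOp p q ∈ S := by
    intro p q
    have hp : p ∈ Submodule.span ℂ (Set.range fun z : EuclideanSpace ℂ (Fin d) ×
        EuclideanSpace ℂ (Fin D) => prodVec k z.1 z.2) := by rw [span_prodVec]; trivial
    have hq : q ∈ Submodule.span ℂ (Set.range fun z : EuclideanSpace ℂ (Fin d) ×
        EuclideanSpace ℂ (Fin D) => prodVec k z.1 z.2) := by rw [span_prodVec]; trivial
    induction hp using Submodule.span_induction with
    | mem p hp =>
      obtain ⟨⟨a, w⟩, rfl⟩ := hp
      induction hq using Submodule.span_induction with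
      | mem q hq =>
        obtain ⟨⟨b, w'⟩, rfl⟩ := hq
        exact Submodule.subset_span ⟨((a, b), (w, w')), rfl⟩
      | zero =>
        convert S.zero_mem
        ext1 v
        simp [rankOneOp_apply]
      | add q q' _ _ h h' =>
        convert S.add_mem h h' using 1
        ext1 v
        simp [rankOneOp_apply]
      | smul c q _ h =>
        convert S.smul_mem c h using 1
        ext1 v
        simp [rankOneOp_apply, smul_smul, mul_comm]
    | zero =>
      convert S.zero_mem
      ext1 v
      simp [rankOneOp_apply]
    | add p p' _ _ h h' =>
      convert S.add_mem h h' using 1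
      ext1 v
      simp [rankOneOp_apply, inner_add_left, add_smul]
    | smul c p _ h =>
      convert S.smul_mem (star c) h using 1
      ext1 v
      simp [rankOneOp_apply, inner_smul_left, smul_smul]
  let e := stdOrthonormalBasis ℂ (symD d k D)
  have hW : W = ∑ i, rankOneOp (e i) (W (e i)) := by
    ext1 v
    conv_lhs => rw [← e.sum_repr' v, map_sum]
    simp only [map_smul, LinearMap.sum_apply, rankOneOp_apply]
    rfl
  rw [hW]
  exact S.sum_mem fun i _ => key _ _

/-- Linear maps on operators are determined by their values on the operators
`|b^{⊗k} ⊗ w'⟩⟨a^{⊗k} ⊗ w|`. -/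
theorem eq_of_eq_on_pureOp {d k D : ℕ} {E : Type*} [AddCommGroup E] [Module ℂ E]
    {f g : SymOp d k D →ₗ[ℂ] E}
    (h : ∀ a b w w', f (pureOp k a b w w') = g (pureOp k a b w w')) : f = g := by
  ext1 W
  refine LinearMap.eqOn_span ?_ (span_pureOp d k D W)
  rintro _ ⟨z, rfl⟩
  exact h _ _ _ _

theorem cform_pureOp {d k D : ℕ} (x a b : EuclideanSpace ℂ (Fin d))
    (y w w' : EuclideanSpace ℂ (Fin D)) :
    cform x y (pureOp k a b w w') =
      (braket x b * braket a x) ^ k * (braket y w' * braket w y) := by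
  change braket (prodVec k x y : TPowD d k D) (pureOp k a b w w' (prodVec k x y) : TPowD d k D) = _
  rw [pureOp, rankOneOp_apply, Submodule.coe_smul, braket, inner_smul_right]
  change _ * braket _ _ = _
  rw [braket_prodVec, braket_prodVec]
  ring

/-! ### Partial traces and their adjoints -/

theorem ext_add {d k D : ℕ} (V W : SymOp d k D) : ext (V + W) = ext V + ext W := by
  ext p r
  simp [ext]

theorem ext_smul {d k D : ℕ} (c : ℂ) (W : SymOp d k D) : ext (c • W) = c • ext W := by
  ext p r
  simp [ext]

theorem compress_add {d k D : ℕ}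
    (A B : Matrix ((Fin k → Fin d) × Fin D) ((Fin k → Fin d) × Fin D) ℂ) :
    compress (A + B) = compress A + compress B := by
  ext1 v
  simp [compress]

theorem compress_smul {d k D : ℕ} (c : ℂ)
    (A : Matrix ((Fin k → Fin d) × Fin D) ((Fin k → Fin d) × Fin D) ℂ) :
    compress (c • A) = c • compress A := by
  ext1 v
  simp [compress]

/-- `trDown t` as a linear map. -/
def trDownₗ (d k D t : ℕ) : SymOp d k D →ₗ[ℂ] SymOp d t D where
  toFun W := trDown t W
  map_add' V W := by
    rw [trDown, trDown, trDown, ← compress_add]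
    congr 1
    ext p r
    simp [ext_add, Finset.sum_add_distrib]
  map_smul' c W := by
    rw [trDown, trDown, RingHom.id_apply, ← compress_smul]
    congr 1
    ext p r
    simp [ext_smul, Finset.mul_sum]

@[simp]
theorem trDownₗ_apply {d k D t : ℕ} (W : SymOp d k D) : trDownₗ d k D t W = trDown t W := rfl

theorem braket_compress {d k D : ℕ}
    (A : Matrix ((Fin k → Fin d) × Fin D) ((Fin k → Fin d) × Fin D) ℂ) (v w : symD d k D) :
    braket (v : TPowD d k D) (compress A w : TPowD d k D) =
      ∑ p, ∑ r, star ((v : TPowD d k D) p) * A p r * (w : TPowD d k D) r := by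
  have h : braket (v : TPowD d k D) (compress A w : TPowD d k D) =
      braket (v : TPowD d k D) (Matrix.toEuclideanLin A (w : TPowD d k D)) :=
    Submodule.inner_orthogonalProjectionOnto_eq_of_mem_left v _
  rw [h, braket_eq_sum]
  refine Finset.sum_congr rfl fun p _ => ?_
  rw [Matrix.toLpLin_apply, Matrix.mulVec_eq_sum]
  simp only [Finset.sum_apply, Pi.smul_apply, Matrix.transpose_apply, MulOpposite.smul_eq_mul_unop,
    MulOpposite.unop_op, Finset.mul_sum, mul_assoc]

/-- On symmetric vectors, the matrix `ext W` acts as `W`. -/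
theorem sum_ext_mul {d k D : ℕ} (W : SymOp d k D) (w : symD d k D) (p : (Fin k → Fin d) × Fin D) :
    ∑ r, ext W p r * (w : TPowD d k D) r = (W w : TPowD d k D) p := by
  have h : w = ∑ r, (w : TPowD d k D) r •
      (symD d k D).orthogonalProjectionOnto (EuclideanSpace.single r (1 : ℂ)) := by
    conv_lhs => rw [← Submodule.orthogonalProjectionOnto_mem_subspace_eq_self w]
    simp only [← map_smul, ← map_sum]
    congr 1
    ext r
    simp [Finset.sum_apply, Pi.single_apply]
  conv_rhs => rw [h, map_sum]
  simp [ext, mul_comm]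

theorem sum_sum_ext {d k D : ℕ} (W : SymOp d k D) (v w : symD d k D) :
    ∑ p, ∑ r, star ((v : TPowD d k D) p) * ext W p r * (w : TPowD d k D) r =
      braket (v : TPowD d k D) (W w : TPowD d k D) := by
  rw [braket_eq_sum]
  refine Finset.sum_congr rfl fun p _ => ?_
  rw [← sum_ext_mul, Finset.mul_sum]
  simp only [mul_assoc]

theorem ext_rankOneOp {d k D : ℕ} (v w : symD d k D) (p r : (Fin k → Fin d) × Fin D) :
    ext (rankOneOp v w) p r = (w : TPowD d k D) p * star ((v : TPowD d k D) r) := by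
  have h : braket (v : TPowD d k D) ((symD d k D).orthogonalProjectionOnto
      (EuclideanSpace.single r (1 : ℂ)) : TPowD d k D) = star ((v : TPowD d k D) r) := by
    refine (Submodule.inner_orthogonalProjectionOnto_eq_of_mem_left v _).trans ?_
    change braket _ _ = _
    simp [braket_eq_sum]
  rw [ext, Matrix.of_apply, rankOneOp_apply, h]
  simp [mul_comm]

/-- Splitting a multi-index of length `k` into its first `t` and its last `k - t` entries. -/
def joinEquiv (d : ℕ) {k t : ℕ} (htk : t ≤ k) :
    (Fin t → Fin d) × (Fin (k - t) → Fin d) ≃ (Fin k → Fin d) where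
  toFun q := joinIdx q.1 q.2
  invFun p := (fun s => p (Fin.castLE htk s), fun s => p ⟨t + s, by omega⟩)
  left_inv q := by
    ext s <;> simp [joinIdx]
  right_inv p := by
    ext u
    by_cases h : (u : ℕ) < t
    · simp [joinIdx, h]
    · simp [joinIdx, h, Nat.add_sub_cancel' (not_lt.1 h)]

theorem joinIdx_castLE {d k t : ℕ} (htk : t ≤ k) (i : Fin t → Fin d) (l : Fin (k - t) → Fin d) :
    (fun s => joinIdx i l (Fin.castLE htk s)) = i := by
  ext s
  simp [joinIdx]

theorem prod_joinIdx {d k t : ℕ} (htk : t ≤ k) (x : Fin d → ℂ) (i : Fin t → Fin d)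
    (l : Fin (k - t) → Fin d) :
    ∏ u, x (joinIdx i l u) = (∏ s, x (i s)) * ∏ s, x (l s) := by
  obtain ⟨r, rfl⟩ := Nat.exists_eq_add_of_le htk
  rw [Fin.prod_univ_add]
  congr 1
  · simp [joinIdx]
  · rw [← (finCongr (Nat.add_sub_cancel_left (n := t) (m := r))).prod_comp]
    simp [joinIdx]

theorem sum_joinIdx {d k t : ℕ} (htk : t ≤ k) {E : Type*} [AddCommMonoid E]
    (f : (Fin k → Fin d) → E) : ∑ i, f i = ∑ i : Fin t → Fin d, ∑ l, f (joinIdx i l) := by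
  rw [← (joinEquiv d htk).sum_comp, Fintype.sum_prod_type]
  rfl

/-- The partial trace of a pure operator is a multiple of the pure operator of lower degree. This
formula determines the partial trace, by `eq_of_eq_on_pureOp`. -/
theorem trDown_pureOp {d k D t : ℕ} (htk : t ≤ k) (a b : EuclideanSpace ℂ (Fin d))
    (w w' : EuclideanSpace ℂ (Fin D)) :
    trDown t (pureOp k a b w w') = braket a b ^ (k - t) • pureOp t a b w w' := by
  have h : trDown t (pureOp k a b w w') = compress (braket a b ^ (k - t) •
      ext (pureOp t a b w w')) := by
    rw [trDown]
    congr 1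
    ext p r
    simp only [Matrix.of_apply, Matrix.smul_apply, pureOp, ext_rankOneOp, prodVec]
    simp only [prod_joinIdx htk, braket_eq_sum, Fintype.sum_pow, smul_eq_mul, Finset.sum_mul,
      star_mul', star_prod, Finset.prod_mul_distrib]
    refine Finset.sum_congr rfl fun l _ => ?_
    ring
  rw [h, compress_smul]
  congr 1
  ext1 v
  rw [compress, LinearMap.comp_apply, LinearMap.comp_apply, Submodule.subtype_apply]
  have h2 : Matrix.toEuclideanLin (ext (pureOp t a b w w')) (v : TPowD d t D) =
      (pureOp t a b w w' v : TPowD d t D) := by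
    ext p
    rw [← sum_ext_mul, Matrix.toLpLin_apply, Matrix.mulVec_eq_sum]
    simp [mul_comm]
  rw [h2]
  exact Submodule.orthogonalProjectionOnto_mem_subspace_eq_self _

theorem trDown_trDown {d k D s t : ℕ} (hst : s ≤ t) (htk : t ≤ k) (W : SymOp d k D) :
    trDown s (trDown t W) = trDown s W := by
  have : trDownₗ d t D s ∘ₗ trDownₗ d k D t = trDownₗ d k D s := by
    refine eq_of_eq_on_pureOp fun a b w w' => ?_
    rw [LinearMap.comp_apply, trDownₗ_apply (t := t), trDown_pureOp htk, map_smul, trDownₗ_apply,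
      trDownₗ_apply, trDown_pureOp hst, trDown_pureOp (hst.trans htk), smul_smul, ← pow_add]
    congr 2
    omega
  exact LinearMap.congr_fun this W

theorem trDown_self {d k D : ℕ} (W : SymOp d k D) : trDown k W = W := by
  have : trDownₗ d k D k = LinearMap.id := by
    refine eq_of_eq_on_pureOp fun a b w w' => ?_
    rw [trDownₗ_apply, trDown_pureOp le_rfl]
    simp
  exact LinearMap.congr_fun this W

/-- On product vectors, `tr*` only contributes a power of the norm. -/
theorem cform_trUp {d k D t : ℕ} (htk : t ≤ k) (X : SymOp d t D) (x : EuclideanSpace ℂ (Fin d))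
    (y : EuclideanSpace ℂ (Fin D)) :
    cform x y (trUp k htk X) = braket x x ^ (k - t) * cform x y X := by
  have h1 : cform x y (trUp k htk X) = _ := braket_compress _ (prodVec k x y) (prodVec k x y)
  have h2 : cform x y X = _ := (sum_sum_ext X (prodVec t x y) (prodVec t x y)).symm
  have hl : ∀ (i i' : Fin t → Fin d) (l l' : Fin (k - t) → Fin d),
      (∀ u : Fin k, t ≤ (u : ℕ) → joinIdx i l u = joinIdx i' l' u) ↔ l = l' := by
    intro i i' l l'
    constructor
    · intro h
      ext s
      have := h ⟨t + s, by omega⟩ (by simp)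
      simpa [joinIdx] using congrArg Fin.val this
    · rintro rfl u hu
      simp [joinIdx, not_lt.2 hu]
  rw [h1, h2]
  simp only [Fintype.sum_prod_type, sum_joinIdx htk, Matrix.of_apply, hl, joinIdx_castLE htk,
    prodVec, prod_joinIdx htk]
  rw [braket_eq_sum, Fintype.sum_pow, Finset.sum_comm, Finset.sum_mul]
  refine Finset.sum_congr rfl fun l _ => ?_
  rw [Finset.mul_sum]
  refine Finset.sum_congr rfl fun i _ => ?_
  rw [Finset.mul_sum]
  refine Finset.sum_congr rfl fun a _ => ?_
  rw [Finset.mul_sum]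
  refine Finset.sum_congr rfl fun i' _ => ?_
  rw [Finset.sum_eq_single l, Finset.mul_sum]
  · refine Finset.sum_congr rfl fun a' _ => ?_
    simp only [if_true, star_mul', star_prod, Finset.prod_mul_distrib]
    ring
  · intro l' _ hl'
    simp [hl'.symm]
  · simp

/-! ### Hermiticity -/

theorem compress_isHermitian {d k D : ℕ}
    {A : Matrix ((Fin k → Fin d) × Fin D) ((Fin k → Fin d) × Fin D) ℂ} (hA : A.IsHermitian) :
    (compress A).IsHermitian := by
  intro v w
  change braket (compress A v : TPowD d k D) (w : TPowD d k D) =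
    braket (v : TPowD d k D) (compress A w : TPowD d k D)
  rw [← star_braket, braket_compress, braket_compress, Finset.sum_comm]
  simp only [star_sum]
  refine Finset.sum_congr rfl fun p _ => Finset.sum_congr rfl fun r _ => ?_
  rw [star_mul', star_mul', hA.apply, star_star]
  ring

theorem ext_isHermitian {d k D : ℕ} {W : SymOp d k D} (hW : W.IsHermitian) :
    (ext W).IsHermitian := by
  have h : ∀ p r, ext W p r = braket ((symD d k D).orthogonalProjectionOnto
      (EuclideanSpace.single p (1 : ℂ)) : TPowD d k D)
      (W ((symD d k D).orthogonalProjectionOnto (EuclideanSpace.single r (1 : ℂ))) :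
        TPowD d k D) := by
    intro p r
    refine Eq.symm ((Submodule.inner_orthogonalProjectionOnto_eq_of_mem_right (K := symD d k D)
      (W ((symD d k D).orthogonalProjectionOnto (EuclideanSpace.single r (1 : ℂ))))
      (EuclideanSpace.single p (1 : ℂ))).trans ?_)
    change braket _ _ = _
    simp [braket_eq_sum, ext]
  refine Matrix.IsHermitian.ext fun p r => ?_
  rw [h, h, star_braket]
  exact hW _ _

theorem trDown_isHermitian {d k D : ℕ} {W : SymOp d k D} (hW : W.IsHermitian) (t : ℕ) :
    (trDown t W).IsHermitian := by
  refine compress_isHermitian (Matrix.IsHermitian.ext fun p r => ?_)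
  simp only [Matrix.of_apply, star_sum, (ext_isHermitian hW).apply]

theorem trUp_isHermitian {d k D t : ℕ} (htk : t ≤ k) {X : SymOp d t D} (hX : X.IsHermitian) :
    (trUp k htk X).IsHermitian := by
  refine compress_isHermitian (Matrix.IsHermitian.ext fun p r => ?_)
  simp only [Matrix.of_apply]
  rw [apply_ite star, (ext_isHermitian hX).apply, star_zero]
  congr 1
  simp only [eq_comm]

theorem tildeOp_isHermitian {d k D : ℕ} (n : ℕ) {W : SymOp d k D} (hW : W.IsHermitian) :
    (tildeOp n W).IsHermitian := by
  refine LinearMap.IsSymmetric.smul (by simp) ?_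
  refine Finset.sum_induction _ (fun X : SymOp d k D => X.IsHermitian)
    (fun _ _ h h' => h.add h') LinearMap.IsSymmetric.zero fun t _ => ?_
  refine LinearMap.IsSymmetric.smul (by simp) ?_
  exact trUp_isHermitian _ (trDown_isHermitian hW _)

/-- The form of `W̃` as a combination of the forms of the partial traces of `W`. -/
theorem cform_tildeOp {d k D : ℕ} (n : ℕ) (W : SymOp d k D) (x : EuclideanSpace ℂ (Fin d))
    (y : EuclideanSpace ℂ (Fin D)) :
    cform x y (tildeOp n W) = (dimSym d (n + k) : ℂ) * ∑ t ∈ Finset.range (k + 1),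
      (coeffQ d n k t : ℂ) * (braket x x ^ (k - t) * cform x y (trDown t W)) := by
  rw [tildeOp, map_smul, map_sum, smul_eq_mul, Finset.sum_range]
  simp only [map_smul, smul_eq_mul, cform_trUp]

/-! ### Moments of spherical designs -/

/-- The moment identity `d[m] ∫ ⟨u|φ⟩^m ⟨φ|v⟩^m dμ(φ) = ⟨u|v⟩^m` on the unit sphere. It is what
`IsSphericalDesign` says about the matrix elements between product vectors. -/
def HasMoments {d : ℕ} (m : ℕ) (μ : Measure (Metric.sphere (0 : EuclideanSpace ℂ (Fin d)) 1)) :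
    Prop :=
  ∀ u v : EuclideanSpace ℂ (Fin d), (dimSym d m : ℂ) *
    ∫ φ, braket u (φ : EuclideanSpace ℂ (Fin d)) ^ m *
      braket (φ : EuclideanSpace ℂ (Fin d)) v ^ m ∂μ = braket u v ^ m

theorem braket_tpow {d n : ℕ} (u v : EuclideanSpace ℂ (Fin d)) :
    braket (tpow n u) (tpow n v) = braket u v ^ n := by
  simp only [braket_eq_sum, Fintype.sum_pow, tpow, star_prod, Finset.prod_mul_distrib]

theorem tpow_mem {d : ℕ} (n : ℕ) (u : EuclideanSpace ℂ (Fin d)) : tpow n u ∈ symSubspace d n := by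
  intro σ i
  exact Equiv.prod_comp σ (fun s => u (i s))

theorem continuous_tpow {d : ℕ} (n : ℕ) :
    Continuous (tpow n : EuclideanSpace ℂ (Fin d) → TPow d n) := by
  unfold tpow
  fun_prop

theorem continuous_rankOne_tpow {d : ℕ} (m : ℕ) :
    Continuous fun x : EuclideanSpace ℂ (Fin d) =>
      InnerProductSpace.rankOne ℂ (tpow m x) (tpow m x) := by
  refine continuous_clm_apply.2 fun v => ?_
  simp only [InnerProductSpace.rankOne_apply]
  exact (Continuous.inner (𝕜 := ℂ) (E := TPow d m) (continuous_tpow m) continuous_const).smul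
    (continuous_tpow m)

/-- The matrix element `A ↦ ⟨u^{⊗m}| A |v^{⊗m}⟩`. -/
def tpowElem {d : ℕ} (m : ℕ) (u v : EuclideanSpace ℂ (Fin d)) :
    (TPow d m →L[ℂ] TPow d m) →L[ℂ] ℂ :=
  (innerSL ℂ (tpow m u)).comp (ContinuousLinearMap.apply ℂ (TPow d m) (tpow m v))

theorem tpowElem_rankOne {d m : ℕ} (u v x : EuclideanSpace ℂ (Fin d)) :
    tpowElem m u v (InnerProductSpace.rankOne ℂ (tpow m x) (tpow m x)) =
      braket u x ^ m * braket x v ^ m := by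
  change braket _ (InnerProductSpace.rankOne ℂ _ _ (tpow m v)) = _
  rw [InnerProductSpace.rankOne_apply, ← braket_tpow, ← braket_tpow, mul_comm]
  exact inner_smul_right (𝕜 := ℂ) (E := TPow d m) _ _ _

section Sphere

variable {d : ℕ} {μ : Measure (Metric.sphere (0 : EuclideanSpace ℂ (Fin d)) 1)}

theorem integrable_of_continuous [IsFiniteMeasure μ] {E : Type*} [NormedAddCommGroup E]
    {f : Metric.sphere (0 : EuclideanSpace ℂ (Fin d)) 1 → E} (hf : Continuous f) :
    Integrable f μ :=
  hf.integrable_of_hasCompactSupport (HasCompactSupport.of_compactSpace f)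

@[fun_prop]
theorem continuous_braket_left (u : EuclideanSpace ℂ (Fin d)) :
    Continuous fun φ : Metric.sphere (0 : EuclideanSpace ℂ (Fin d)) 1 =>
      braket u (φ : EuclideanSpace ℂ (Fin d)) :=
  continuous_const.inner continuous_subtype_val

@[fun_prop]
theorem continuous_braket_right (u : EuclideanSpace ℂ (Fin d)) :
    Continuous fun φ : Metric.sphere (0 : EuclideanSpace ℂ (Fin d)) 1 =>
      braket (φ : EuclideanSpace ℂ (Fin d)) u :=
  continuous_subtype_val.inner continuous_const

theorem IsSphericalDesign.hasMoments {m : ℕ} (h : IsSphericalDesign d m μ) : HasMoments m μ := by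
  have := h.finite
  intro u v
  have hc : Continuous fun φ : Metric.sphere (0 : EuclideanSpace ℂ (Fin d)) 1 =>
      InnerProductSpace.rankOne ℂ (tpow m (φ : EuclideanSpace ℂ (Fin d)))
        (tpow m (φ : EuclideanSpace ℂ (Fin d))) :=
    (continuous_rankOne_tpow (d := d) m).comp continuous_subtype_val
  have hL := congrArg (tpowElem m u v) h.integral_eq
  rw [map_smul, ← (tpowElem m u v).integral_comp_comm (integrable_of_continuous hc)] at hL
  simp only [tpowElem_rankOne] at hL
  have hr : tpowElem m u v (symSubspace d m).starProjection = braket u v ^ m := by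
    rw [← braket_tpow]
    change braket _ ((symSubspace d m).starProjection (tpow m v)) = _
    rw [Submodule.starProjection_eq_self_iff.2 (tpow_mem m v)]
  rw [← hr, ← hL, smul_eq_mul]

variable [IsFiniteMeasure μ]

theorem coeff_linear_pow (α γ : ℂ) (n i : ℕ) :
    ((Polynomial.C α + Polynomial.C γ * Polynomial.X) ^ n).coeff i =
      n.choose i * α ^ (n - i) * γ ^ i := by
  rw [add_comm, add_pow, Polynomial.finsetSum_coeff]
  have : ∀ j ∈ Finset.range (n + 1), ((Polynomial.C γ * Polynomial.X) ^ j *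
      Polynomial.C α ^ (n - j) * (n.choose j : Polynomial ℂ)).coeff i =
      if i = j then n.choose j * α ^ (n - j) * γ ^ j else 0 := by
    intro j _
    rw [show (Polynomial.C γ * Polynomial.X) ^ j * Polynomial.C α ^ (n - j) *
      (n.choose j : Polynomial ℂ) = Polynomial.C (n.choose j * α ^ (n - j) * γ ^ j) *
        Polynomial.X ^ j by
      simp only [map_mul, map_pow, map_natCast, mul_pow]
      ring, Polynomial.coeff_C_mul_X_pow]
  rw [Finset.sum_congr rfl this, Finset.sum_ite_eq]
  split_ifs with h
  · rfl
  · rw [Nat.choose_eq_zero_of_lt (by simpa using h)]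
    simp

/-- If `∫ G (A + εB)^m = p(ε)` for all `ε`, then the coefficients of `p` are the mixed moments. -/
theorem coeff_eq_integral {m : ℕ} {G A B : Metric.sphere (0 : EuclideanSpace ℂ (Fin d)) 1 → ℂ}
    (hG : Continuous G) (hA : Continuous A) (hB : Continuous B) (p : Polynomial ℂ)
    (h : ∀ ε : ℂ, ∫ φ, G φ * (A φ + ε * B φ) ^ m ∂μ = p.eval ε) (t : ℕ) :
    p.coeff t = m.choose t * ∫ φ, G φ * (A φ ^ (m - t) * B φ ^ t) ∂μ := by
  have hp : p = ∑ i ∈ Finset.range (m + 1), Polynomial.C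
      (m.choose i * ∫ φ, G φ * (A φ ^ (m - i) * B φ ^ i) ∂μ) * Polynomial.X ^ i := by
    apply Polynomial.funext
    intro ε
    rw [← h, Polynomial.eval_finsetSum]
    simp only [Polynomial.eval_mul, Polynomial.eval_C, Polynomial.eval_pow, Polynomial.eval_X]
    have : ∀ φ, G φ * (A φ + ε * B φ) ^ m = ∑ i ∈ Finset.range (m + 1),
        (m.choose i * ε ^ i) * (G φ * (A φ ^ (m - i) * B φ ^ i)) := by
      intro φ
      rw [add_comm, add_pow, Finset.mul_sum]
      refine Finset.sum_congr rfl fun i _ => ?_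
      rw [mul_pow]
      ring
    simp only [this]
    rw [integral_finsetSum _ fun i _ => integrable_of_continuous (by fun_prop)]
    refine Finset.sum_congr rfl fun i _ => ?_
    rw [integral_const_mul]
    ring
  conv_lhs => rw [hp]
  simp only [Polynomial.finsetSum_coeff, Polynomial.coeff_C_mul_X_pow, Finset.sum_ite_eq]
  split_ifs with ht
  · rfl
  · rw [Nat.choose_eq_zero_of_lt (by simpa using ht)]
    simp

theorem braket_add_smul_left {ι : Type} [Fintype ι] (x a v : EuclideanSpace ℂ ι) (ε : ℂ) :
    braket (x + star ε • a) v = braket x v + ε * braket a v := by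
  simp [braket, inner_add_left, inner_smul_left]

theorem braket_add_smul_right {ι : Type} [Fintype ι] (x a v : EuclideanSpace ℂ ι) (ε : ℂ) :
    braket v (x + ε • a) = braket v x + ε * braket v a := by
  simp [braket, inner_add_right, inner_smul_right]

/-- Polarization of the moment identity: the mixed moments of degree `n` in the pair `x, z` and of
degree `t` in the pair `a, b`. They are coefficients of
`(⟨x|z⟩ + ε⟨a|z⟩ + δ⟨x|b⟩ + εδ⟨a|b⟩)^(n+t)`. -/
theorem HasMoments.mixed {n t : ℕ} (h : HasMoments (n + t) μ)
    (x a z b : EuclideanSpace ℂ (Fin d)) :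
    (dimSym d (n + t) : ℂ) * ((n + t).choose t : ℂ) *
      ∫ φ : Metric.sphere (0 : EuclideanSpace ℂ (Fin d)) 1,
        (braket x (φ : EuclideanSpace ℂ (Fin d)) ^ n *
          braket a (φ : EuclideanSpace ℂ (Fin d)) ^ t) *
        (braket (φ : EuclideanSpace ℂ (Fin d)) z ^ n * braket (φ : EuclideanSpace ℂ (Fin d)) b ^ t)
          ∂μ =
      ∑ s ∈ Finset.range (t + 1), (n.choose s : ℂ) * (t.choose s : ℂ) * braket x z ^ (n - s) *
        ((braket x b * braket a z) ^ s * braket a b ^ (t - s)) := by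
  -- the case of a single vector in the second slot
  have step : ∀ v : EuclideanSpace ℂ (Fin d), (dimSym d (n + t) : ℂ) *
      ∫ φ : Metric.sphere (0 : EuclideanSpace ℂ (Fin d)) 1,
        (braket x (φ : EuclideanSpace ℂ (Fin d)) ^ n *
          braket a (φ : EuclideanSpace ℂ (Fin d)) ^ t) *
        braket (φ : EuclideanSpace ℂ (Fin d)) v ^ (n + t) ∂μ =
      braket x v ^ n * braket a v ^ t := by
    intro v
    have h1 := coeff_eq_integral (μ := μ) (m := n + t)
      (G := fun φ => (dimSym d (n + t) : ℂ) * braket (φ : EuclideanSpace ℂ (Fin d)) v ^ (n + t))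
      (A := fun φ => braket x (φ : EuclideanSpace ℂ (Fin d)))
      (B := fun φ => braket a (φ : EuclideanSpace ℂ (Fin d)))
      (by fun_prop) (by fun_prop) (by fun_prop)
      ((Polynomial.C (braket x v) + Polynomial.C (braket a v) * Polynomial.X) ^ (n + t))
      (by
        intro ε
        have := h (x + star ε • a) v
        rw [← integral_const_mul] at this
        simp only [braket_add_smul_left] at this
        simp only [Polynomial.eval_pow, Polynomial.eval_add, Polynomial.eval_C,
          Polynomial.eval_mul, Polynomial.eval_X]
        rw [mul_comm (braket a v), ← this]
        congr 1
        funext φ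
        ring) t
    rw [coeff_linear_pow, Nat.add_sub_cancel] at h1
    have hne : ((n + t).choose t : ℂ) ≠ 0 :=
      Nat.cast_ne_zero.2 (Nat.choose_pos (Nat.le_add_left t n)).ne'
    rw [mul_assoc] at h1
    rw [mul_left_cancel₀ hne h1, ← integral_const_mul]
    congr 1
    funext φ
    ring
  have h2 := coeff_eq_integral (μ := μ) (m := n + t)
    (G := fun φ => (dimSym d (n + t) : ℂ) * (braket x (φ : EuclideanSpace ℂ (Fin d)) ^ n *
      braket a (φ : EuclideanSpace ℂ (Fin d)) ^ t))
    (A := fun φ => braket (φ : EuclideanSpace ℂ (Fin d)) z)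
    (B := fun φ => braket (φ : EuclideanSpace ℂ (Fin d)) b)
    (by fun_prop) (by fun_prop) (by fun_prop)
    ((Polynomial.C (braket x z) + Polynomial.C (braket x b) * Polynomial.X) ^ n *
      (Polynomial.C (braket a z) + Polynomial.C (braket a b) * Polynomial.X) ^ t)
    (by
      intro ε
      have := step (z + ε • b)
      rw [← integral_const_mul] at this
      simp only [braket_add_smul_right] at this
      simp only [Polynomial.eval_pow, Polynomial.eval_add, Polynomial.eval_C,
        Polynomial.eval_mul, Polynomial.eval_X]
      rw [mul_comm (braket a b), mul_comm (braket x b), ← this]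
      congr 1
      funext φ
      ring) t
  rw [Polynomial.coeff_mul, Nat.add_sub_cancel] at h2
  simp only [coeff_linear_pow] at h2
  rw [Finset.Nat.sum_antidiagonal_eq_sum_range_succ_mk] at h2
  simp only [mul_assoc, integral_const_mul] at h2 ⊢
  rw [mul_left_comm, ← h2]
  refine Finset.sum_congr rfl fun s hs => ?_
  have hs' : s ≤ t := Nat.lt_succ_iff.1 (Finset.mem_range.1 hs)
  rw [Nat.choose_symm hs', Nat.sub_sub_self hs']
  ring

theorem dimSym_succ_mul {d : ℕ} (hd : 0 < d) (m : ℕ) :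
    dimSym d (m + 1) * (m + 1) = dimSym d m * (d + m) := by
  obtain ⟨e, rfl⟩ := Nat.exists_eq_add_of_lt hd
  have := Nat.add_one_mul_choose_eq (e + m) m
  simp only [dimSym]
  rw [show 0 + e + 1 + (m + 1) - 1 = e + m + 1 by omega, show 0 + e + 1 + m - 1 = e + m by omega,
    ← this]
  ring

theorem braket_self_sphere (φ : Metric.sphere (0 : EuclideanSpace ℂ (Fin d)) 1) :
    braket (φ : EuclideanSpace ℂ (Fin d)) (φ : EuclideanSpace ℂ (Fin d)) = 1 := by
  have : ‖(φ : EuclideanSpace ℂ (Fin d))‖ = 1 := by simp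
  rw [braket_self, this]
  simp

/-- An `(m+1)`-design is an `m`-design: on the unit sphere, tracing out one factor in the mixed
moments leaves the moments of degree `m`. -/
theorem HasMoments.of_succ (hd : 0 < d) {m : ℕ} (h : HasMoments (m + 1) μ) : HasMoments m μ := by
  intro u v
  let e := EuclideanSpace.basisFun (Fin d) ℂ
  have he : ∀ x z : EuclideanSpace ℂ (Fin d), ∑ i, braket x (e i) * braket (e i) z = braket x z :=
    fun x z => e.sum_inner_mul_inner x z
  have h1 := Finset.sum_congr (rfl : (Finset.univ : Finset (Fin d)) = Finset.univ)
    fun i _ => h.mixed (t := 1) u (e i) v (e i)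
  rw [← Finset.mul_sum, ← integral_finsetSum _
    fun i _ => integrable_of_continuous (by fun_prop)] at h1
  have h2 : ∀ φ : Metric.sphere (0 : EuclideanSpace ℂ (Fin d)) 1,
      ∑ i, (braket u (φ : EuclideanSpace ℂ (Fin d)) ^ m *
          braket (e i) (φ : EuclideanSpace ℂ (Fin d)) ^ 1) *
        (braket (φ : EuclideanSpace ℂ (Fin d)) v ^ m *
          braket (φ : EuclideanSpace ℂ (Fin d)) (e i) ^ 1) =
      braket u (φ : EuclideanSpace ℂ (Fin d)) ^ m *
        braket (φ : EuclideanSpace ℂ (Fin d)) v ^ m := by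
    intro φ
    calc _ = braket u (φ : EuclideanSpace ℂ (Fin d)) ^ m *
          braket (φ : EuclideanSpace ℂ (Fin d)) v ^ m *
          ∑ i, braket (φ : EuclideanSpace ℂ (Fin d)) (e i) *
            braket (e i) (φ : EuclideanSpace ℂ (Fin d)) := by
          rw [Finset.mul_sum]
          refine Finset.sum_congr rfl fun i _ => ?_
          ring
      _ = _ := by rw [he, braket_self_sphere, mul_one]
  have h3 : ∀ i, braket (e i) (e i) = 1 := fun i => by
    rw [braket_self, e.norm_eq_one]
    simp
  simp only [h2, Finset.sum_range_succ, Finset.range_zero, Finset.sum_empty, h3] at h1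
  have h4 : ∑ i, braket u (e i) * braket (e i) v * (m * braket u v ^ (m - 1)) =
      m * braket u v ^ m := by
    rw [← Finset.sum_mul, he]
    rcases m with _ | m
    · simp
    · rw [Nat.add_sub_cancel]
      ring
  have h5 : ((d + m : ℕ) : ℂ) * ((dimSym d m : ℂ) *
      ∫ φ, braket u (φ : EuclideanSpace ℂ (Fin d)) ^ m *
        braket (φ : EuclideanSpace ℂ (Fin d)) v ^ m ∂μ) = ((d + m : ℕ) : ℂ) * braket u v ^ m := by
    have hdim : (dimSym d (m + 1) : ℂ) * (m + 1) = dimSym d m * (d + m) := by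
      exact_mod_cast dimSym_succ_mul hd m
    rw [← mul_assoc, mul_comm ((d + m : ℕ) : ℂ), Nat.cast_add, ← hdim]
    simp only [Nat.choose_one_right, Nat.cast_add, Nat.cast_one] at h1
    rw [h1, add_mul]
    conv_rhs => rw [← h4]
    simp [Finset.sum_add_distrib]
    exact Finset.sum_congr rfl fun i _ => mul_comm _ _
  exact mul_left_cancel₀ (Nat.cast_ne_zero.2 (by omega)) h5

theorem HasMoments.of_le (hd : 0 < d) {l m : ℕ} (hlm : l ≤ m) (h : HasMoments m μ) :
    HasMoments l μ := by
  induction hlm using Nat.decreasingInduction with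
  | self => exact h
  | of_succ k _ ih => exact ih.of_succ hd

theorem continuous_cform {t D : ℕ} (V : SymOp d t D) (y : EuclideanSpace ℂ (Fin D)) :
    Continuous fun φ : Metric.sphere (0 : EuclideanSpace ℂ (Fin d)) 1 =>
      cform (φ : EuclideanSpace ℂ (Fin d)) y V := by
  have hV : Continuous fun v : symD d t D => V v := V.continuous_of_finiteDimensional
  have hv : Continuous fun φ : Metric.sphere (0 : EuclideanSpace ℂ (Fin d)) 1 =>
      prodVec t (φ : EuclideanSpace ℂ (Fin d)) y :=
    (continuous_prodVec t).comp (continuous_subtype_val.prodMk continuous_const)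
  exact (continuous_subtype_val.comp hv).inner (continuous_subtype_val.comp (hV.comp hv))

/-- Integrating a form of bidegree `(t, t)` against `|⟨φ|x⟩|^{2n}` gives a combination of the forms
of its partial traces. -/
theorem HasMoments.integral_cform {n t D : ℕ} (h : HasMoments (n + t) μ) (V : SymOp d t D)
    (x : EuclideanSpace ℂ (Fin d)) (y : EuclideanSpace ℂ (Fin D)) :
    (dimSym d (n + t) : ℂ) * ((n + t).choose t : ℂ) *
      ∫ φ : Metric.sphere (0 : EuclideanSpace ℂ (Fin d)) 1,
        (braket x (φ : EuclideanSpace ℂ (Fin d)) ^ n *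
          braket (φ : EuclideanSpace ℂ (Fin d)) x ^ n) *
          cform (φ : EuclideanSpace ℂ (Fin d)) y V ∂μ =
      ∑ s ∈ Finset.range (t + 1), (n.choose s : ℂ) * (t.choose s : ℂ) * braket x x ^ (n - s) *
        cform x y (trDown s V) := by
  let f : SymOp d t D →ₗ[ℂ] ℂ :=
    { toFun := fun V => (dimSym d (n + t) : ℂ) * ((n + t).choose t : ℂ) *
        ∫ φ : Metric.sphere (0 : EuclideanSpace ℂ (Fin d)) 1,
          (braket x (φ : EuclideanSpace ℂ (Fin d)) ^ n *
            braket (φ : EuclideanSpace ℂ (Fin d)) x ^ n) *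
            cform (φ : EuclideanSpace ℂ (Fin d)) y V ∂μ
      map_add' := by
        intro V V'
        have := continuous_cform V y
        have := continuous_cform V' y
        rw [← mul_add, ← integral_add (integrable_of_continuous (by fun_prop))
          (integrable_of_continuous (by fun_prop))]
        simp only [map_add, mul_add]
      map_smul' := by
        intro c V
        simp only [map_smul, smul_eq_mul, RingHom.id_apply, mul_left_comm _ c, integral_const_mul] }
  let g : SymOp d t D →ₗ[ℂ] ℂ := ∑ s ∈ Finset.range (t + 1),
    ((n.choose s : ℂ) * (t.choose s : ℂ) * braket x x ^ (n - s)) • (cform x y ∘ₗ trDownₗ d t D s)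
  -- both sides are linear in `V`, and for pure operators they are the mixed moments
  have hfg : f = g := by
    refine eq_of_eq_on_pureOp fun a b w w' => ?_
    have h1 := congrArg (fun c => c * (braket y w' * braket w y)) (h.mixed x a x b)
    simp only [f, g, LinearMap.coe_mk, AddHom.coe_mk, cform_pureOp, LinearMap.sum_apply,
      LinearMap.smul_apply, LinearMap.comp_apply, smul_eq_mul]
    convert h1 using 1
    · rw [mul_assoc _ _ (braket y w' * braket w y), ← integral_mul_const]
      congr 2
      funext φ
      ring
    · rw [Finset.sum_mul]
      refine Finset.sum_congr rfl fun s hs => ?_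
      rw [trDownₗ_apply, trDown_pureOp (by simpa [Nat.lt_succ_iff] using hs), map_smul,
        cform_pureOp, smul_eq_mul]
      ring
  have := LinearMap.congr_fun hfg V
  simpa [f, g] using this

/-! ### The integral formula -/

/-- Binomial inversion, read off from `X^k = ((1 + X) - 1)^k`. -/
theorem sum_neg_one_pow_choose_mul_choose {s k : ℕ} (hsk : s ≤ k) :
    ∑ t ∈ Finset.range (k + 1), ((-1) ^ (t + k) * (k.choose t : ℂ) * (t.choose s : ℂ)) =
      if s = k then 1 else 0 := by
  have h := coeff_linear_pow (-1 + 1) 1 k s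
  have h2 : (Polynomial.C (-1 + 1 : ℂ) + Polynomial.C 1 * Polynomial.X) ^ k =
      ∑ t ∈ Finset.range (k + 1), Polynomial.C ((-1) ^ (k - t) * (k.choose t : ℂ)) *
        (Polynomial.C 1 + Polynomial.C 1 * Polynomial.X) ^ t := by
    rw [map_add, show (Polynomial.C (-1 : ℂ) + Polynomial.C 1 + Polynomial.C 1 * Polynomial.X) =
      (Polynomial.C 1 + Polynomial.C 1 * Polynomial.X) + Polynomial.C (-1) by ring, add_pow]
    refine Finset.sum_congr rfl fun t _ => ?_
    simp only [map_mul, map_pow, map_natCast]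
    ring
  rw [h2, Polynomial.finsetSum_coeff] at h
  simp only [Polynomial.coeff_C_mul, coeff_linear_pow, one_pow, mul_one] at h
  have h3 : ∀ t ∈ Finset.range (k + 1), ((-1) ^ (t + k) * (k.choose t : ℂ) * (t.choose s : ℂ)) =
      (-1) ^ (k - t) * (k.choose t : ℂ) * (t.choose s : ℂ) := by
    intro t ht
    have : t ≤ k := by simpa [Nat.lt_succ_iff] using ht
    rw [show t + k = (k - t) + 2 * t by omega, pow_add, pow_mul]
    simp
  rw [Finset.sum_congr rfl h3, h]
  split_ifs with hs
  · subst hs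
    simp
  · rw [neg_add_cancel, zero_pow (by omega)]
    simp

theorem dimSym_pos (hd : 0 < d) (m : ℕ) : 0 < dimSym d m :=
  Nat.choose_pos (by omega)

/-- The integral representation of `‖x‖^{2(n-k)} p_W(x, y)`, in complex form. The forms of the
partial traces of `W` are integrated one by one; on the sphere, `tr*` does not change them, and the
alternating signs in `q(n,k,t)` leave only the term of `W` itself. -/
theorem HasMoments.integral_cform_tildeOp {n k D : ℕ} (hd : 0 < d) (hkn : k ≤ n)
    (h : HasMoments (n + k) μ) (W : SymOp d k D)
    (x : EuclideanSpace ℂ (Fin d)) (y : EuclideanSpace ℂ (Fin D)) :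
    ∫ φ : Metric.sphere (0 : EuclideanSpace ℂ (Fin d)) 1,
      (braket x (φ : EuclideanSpace ℂ (Fin d)) ^ n * braket (φ : EuclideanSpace ℂ (Fin d)) x ^ n) *
        cform (φ : EuclideanSpace ℂ (Fin d)) y (tildeOp n W) ∂μ =
      braket x x ^ (n - k) * cform x y W := by
  have hdim : ∀ m, (dimSym d m : ℂ) ≠ 0 := fun m => Nat.cast_ne_zero.2 (dimSym_pos hd m).ne'
  have hnk : (n.choose k : ℂ) ≠ 0 := Nat.cast_ne_zero.2 (Nat.choose_pos hkn).ne'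
  have h1 : ∀ φ : Metric.sphere (0 : EuclideanSpace ℂ (Fin d)) 1,
      (braket x (φ : EuclideanSpace ℂ (Fin d)) ^ n * braket (φ : EuclideanSpace ℂ (Fin d)) x ^ n) *
        cform (φ : EuclideanSpace ℂ (Fin d)) y (tildeOp n W) =
      ∑ t ∈ Finset.range (k + 1), ((-1) ^ (t + k) * (k.choose t : ℂ) / (n.choose k : ℂ)) *
        (((dimSym d (n + t) : ℂ) * ((n + t).choose t : ℂ)) *
        ((braket x (φ : EuclideanSpace ℂ (Fin d)) ^ n *
          braket (φ : EuclideanSpace ℂ (Fin d)) x ^ n) *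
          cform (φ : EuclideanSpace ℂ (Fin d)) y (trDown t W))) := by
    intro φ
    rw [cform_tildeOp, Finset.mul_sum, Finset.mul_sum]
    refine Finset.sum_congr rfl fun t _ => ?_
    rw [braket_self_sphere, one_pow, coeffQ]
    have := hdim (n + k)
    push_cast
    field_simp
  simp only [h1]
  have hc : ∀ t, Continuous fun φ : Metric.sphere (0 : EuclideanSpace ℂ (Fin d)) 1 =>
      cform (φ : EuclideanSpace ℂ (Fin d)) y (trDown t W) := fun t => continuous_cform _ y
  rw [integral_finsetSum _ fun t _ => integrable_of_continuous (by have := hc t; fun_prop)]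
  have h2 : ∀ t ∈ Finset.range (k + 1),
      ∫ φ : Metric.sphere (0 : EuclideanSpace ℂ (Fin d)) 1,
        ((-1) ^ (t + k) * (k.choose t : ℂ) / (n.choose k : ℂ)) *
        (((dimSym d (n + t) : ℂ) * ((n + t).choose t : ℂ)) *
        ((braket x (φ : EuclideanSpace ℂ (Fin d)) ^ n *
          braket (φ : EuclideanSpace ℂ (Fin d)) x ^ n) *
          cform (φ : EuclideanSpace ℂ (Fin d)) y (trDown t W))) ∂μ =
      ∑ s ∈ Finset.range (k + 1), ((-1) ^ (t + k) * (k.choose t : ℂ) * (t.choose s : ℂ)) *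
        ((n.choose s : ℂ) / (n.choose k : ℂ) * braket x x ^ (n - s) *
          cform x y (trDown s W)) := by
    intro t ht
    have htk : t ≤ k := by simpa [Nat.lt_succ_iff] using ht
    rw [integral_const_mul, integral_const_mul,
      (h.of_le hd (Nat.add_le_add_left htk n)).integral_cform (trDown t W) x y, Finset.mul_sum]
    refine Eq.trans (Finset.sum_congr rfl fun s hs => ?_) (Finset.sum_subset
      (Finset.range_mono (Nat.succ_le_succ htk)) fun s _ hs => ?_)
    · rw [trDown_trDown (by simpa [Nat.lt_succ_iff] using hs) htk]
      ring
    · rw [Nat.choose_eq_zero_of_lt (show t < s by simpa using hs)]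
      simp
  rw [Finset.sum_congr rfl h2, Finset.sum_comm]
  have h3 : ∀ s ∈ Finset.range (k + 1), ∑ t ∈ Finset.range (k + 1),
      ((-1) ^ (t + k) * (k.choose t : ℂ) * (t.choose s : ℂ)) *
        ((n.choose s : ℂ) / (n.choose k : ℂ) * braket x x ^ (n - s) * cform x y (trDown s W)) =
      if s = k then braket x x ^ (n - k) * cform x y W else 0 := by
    intro s hs
    rw [← Finset.sum_mul, sum_neg_one_pow_choose_mul_choose (by simpa [Nat.lt_succ_iff] using hs)]
    split_ifs with hsk
    · subst hsk
      rw [trDown_self, div_self hnk]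
      ring
    · rw [zero_mul]
  rw [Finset.sum_congr rfl h3]
  simp

theorem braket_mul_braket_pow (x φ : EuclideanSpace ℂ (Fin d)) (n : ℕ) :
    braket x φ ^ n * braket φ x ^ n = ((‖braket φ x‖ ^ (2 * n) : ℝ) : ℂ) := by
  rw [← mul_pow, ← star_braket φ x, pow_mul, Complex.ofReal_pow, Complex.ofReal_pow]
  congr 1
  exact Complex.conj_mul' _

theorem HasMoments.integral_form_tildeOp {n k D : ℕ} (hd : 0 < d) (hkn : k ≤ n)
    (h : HasMoments (n + k) μ) {W : SymOp d k D} (hW : W.IsHermitian)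
    (x : EuclideanSpace ℂ (Fin d)) (y : EuclideanSpace ℂ (Fin D)) :
    ‖x‖ ^ (2 * (n - k)) * form W x y = ∫ φ : Metric.sphere (0 : EuclideanSpace ℂ (Fin d)) 1,
      form (tildeOp n W) (φ : EuclideanSpace ℂ (Fin d)) y *
        ‖braket (φ : EuclideanSpace ℂ (Fin d)) x‖ ^ (2 * n) ∂μ := by
  have h1 := h.integral_cform_tildeOp hd hkn W x y
  simp only [braket_mul_braket_pow, cform_eq_form (tildeOp_isHermitian n hW),
    cform_eq_form hW, ← Complex.ofReal_mul, integral_complex_ofReal] at h1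
  have hx : braket x x = ((‖x‖ ^ 2 : ℝ) : ℂ) := by
    rw [braket_self]
    simp
  rw [hx, ← Complex.ofReal_pow, ← Complex.ofReal_mul, Complex.ofReal_inj, ← pow_mul] at h1
  rw [← h1]
  simp only [mul_comm]

end Sphere

/-! ### A Markov-type inequality for polynomials in Bernstein form -/

open Polynomial in
/-- Among the real polynomials `Q` of degree at most `k` that are bounded by `1` on `[-1, 1]`, the
functional `2 Q'(1) - k Q(1)` is largest at the Chebyshev polynomial `T_k`: expressed by the values
of `Q` at the extremal points of `T_k`, it has coefficients of alternating sign. -/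
theorem two_mul_derivative_sub_le {k : ℕ} (Q : ℝ[X]) (hdeg : Q.degree ≤ k)
    (hQ : ∀ x ∈ Set.Icc (-1 : ℝ) 1, |Q.eval x| ≤ 1) :
    2 * (derivative Q).eval 1 - k * Q.eval 1 ≤ 2 * k ^ 2 - k := by
  classical
  set v : ℕ → ℝ := fun i => Chebyshev.node k i with hv
  set s := Finset.range (k + 1) with hs
  set w : ℕ → ℝ := fun i => ∏ j ∈ s.erase i, (v i - v j) with hw
  set E : ℕ → ℝ := fun i => ∑ a ∈ s.erase i, ∏ b ∈ (s.erase i).erase a, (1 - v b) with hE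
  set c : ℕ → ℝ := fun i => (w i)⁻¹ * (2 * E i) - if i = 0 then (k : ℝ) else 0 with hc
  have hv1 : ∀ i, v i ≤ 1 := fun i => Real.cos_le_one _
  have hv2 : ∀ i, -1 ≤ v i := fun i => Real.neg_one_le_cos _
  have hv0 : v 0 = 1 := Chebyshev.node_eq_one
  have hinj : Set.InjOn v s := (Chebyshev.strictAntiOn_node k).injOn
  have hE0 : ∀ i, 0 ≤ E i := fun i =>
    Finset.sum_nonneg fun a _ => Finset.prod_nonneg fun b _ => sub_nonneg.2 (hv1 b)
  have hsign : ∀ i ≤ k, 0 ≤ (-1) ^ i * c i := by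
    intro i hi
    have hpos : 0 < (-1) ^ i * w i := Chebyshev.zero_lt_prod_node_sub_node hi
    have hpos' : 0 < (-1) ^ i * (w i)⁻¹ := by
      have := inv_pos_of_pos hpos
      rwa [mul_inv, ← inv_pow, inv_neg_one] at this
    by_cases h0 : i = 0
    · subst h0
      simp only [pow_zero, one_mul] at hpos hpos' ⊢
      -- every factor `1 - v a` is at most `2`
      have : k * w 0 ≤ 2 * E 0 := by
        have hcard : (k : ℝ) = (s.erase 0).card := by
          rw [Finset.card_erase_of_mem (by simp [hs])]
          simp [hs]
        rw [hcard, hE, Finset.mul_sum, ← nsmul_eq_mul]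
        refine Finset.card_nsmul_le_sum _ _ _ fun a ha => ?_
        simp only [hw, hv0]
        rw [← Finset.mul_prod_erase _ _ ha]
        refine mul_le_mul_of_nonneg_right (by linarith [hv2 a]) ?_
        exact Finset.prod_nonneg fun b _ => sub_nonneg.2 (hv1 b)
      simp only [hc, if_true]
      rw [sub_nonneg, inv_mul_eq_div, le_div_iff₀ hpos]
      exact this
    · simp only [hc, if_neg h0, sub_zero]
      rw [← mul_assoc]
      exact mul_nonneg hpos'.le (mul_nonneg zero_le_two (hE0 i))
  have hval : ∀ P : ℝ[X], P.degree ≤ k →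
      Chebyshev.sumNodes k c P = 2 * (derivative P).eval 1 - k * P.eval 1 := by
    intro P hP
    have hP' : P.degree < s.card := by
      rw [hs, Finset.card_range]
      exact lt_of_le_of_lt hP (by exact_mod_cast Nat.lt_succ_self k)
    have hP1 : P = ∑ i ∈ s, C (P.eval (v i) / w i) * ∏ j ∈ s.erase i, (X - C (v j)) := by
      conv_lhs => rw [Lagrange.eq_interpolate hinj hP', Lagrange.interpolate_eq_sum]
    have hd : (derivative P).eval 1 = ∑ i ∈ s, P.eval (v i) / w i * E i := by
      conv_lhs => rw [hP1]
      simp only [derivative_sum, derivative_C_mul, eval_finsetSum, eval_mul, eval_C]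
      refine Finset.sum_congr rfl fun i _ => ?_
      rw [derivative_prod_finset]
      simp [eval_finsetSum, eval_prod, hE]
    have h1 : P.eval 1 = ∑ i ∈ s, P.eval (v i) * if i = 0 then 1 else 0 := by
      rw [Finset.sum_eq_single 0]
      · simp [hv0]
      · intro b _ hb
        simp [hb]
      · simp [hs]
    rw [hd, h1, Chebyshev.sumNodes, ← Nat.range_succ_eq_Iic, Finset.mul_sum, Finset.mul_sum,
      ← Finset.sum_sub_distrib]
    refine Finset.sum_congr rfl fun i _ => ?_
    simp only [hc]
    split_ifs
    · ring
    · ring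
  have h := Chebyshev.sumNodes_le_sumNodes_T hsign hQ
  rw [hval Q hdeg, hval _ (by simp)] at h
  have hT := Chebyshev.iterate_derivative_T_eval_one_recurrence (R := ℝ) k 0
  simp only [Function.iterate_zero, id, Chebyshev.T_eval_one, Function.iterate_one, zero_add,
    Nat.cast_zero] at hT
  rw [Chebyshev.T_eval_one] at h
  push_cast at hT
  linarith

open Polynomial in
/-- If `∑ c_j s^j (1-s)^(k-j)` is bounded by `M` on `[0, 1]`, then `|c_1| ≤ k (2k-1) M`. Equality
holds for `T_k(1-2s)`, whose first coefficient is `-binom (2k) 2`. -/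
theorem abs_coeff_one_le {k : ℕ} (hk : 1 ≤ k) (c : ℕ → ℝ) {M : ℝ} (hM : 0 < M)
    (h : ∀ s ∈ Set.Icc (0 : ℝ) 1,
      |∑ j ∈ Finset.range (k + 1), c j * ((1 - s) ^ (k - j) * s ^ j)| ≤ M) :
    |c 1| ≤ k * (2 * k - 1) * M := by
  set Q : ℝ[X] := ∑ j ∈ Finset.range (k + 1), C (c j / M) *
    ((C (1 / 2) * (X + 1)) ^ (k - j) * (C (1 / 2) * (1 - X)) ^ j) with hQ
  have hdeg : Q.degree ≤ k := by
    refine (degree_sum_le _ _).trans (Finset.sup_le fun j hj => ?_)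
    have hj' : j ≤ k := Nat.lt_succ_iff.1 (Finset.mem_range.1 hj)
    have h1 : (C (1 / 2 : ℝ) * (X + 1)).natDegree ≤ 1 := by compute_degree
    have h2 : (C (1 / 2 : ℝ) * (1 - X)).natDegree ≤ 1 := by compute_degree
    refine natDegree_le_iff_degree_le.1 ?_
    refine (natDegree_C_mul_le _ _).trans (natDegree_mul_le.trans ?_)
    have h3 := natDegree_pow_le_of_le (k - j) h1
    have h4 := natDegree_pow_le_of_le j h2
    omega
  have heval : ∀ x, Q.eval x = (∑ j ∈ Finset.range (k + 1), c j *
      ((1 - (1 - x) / 2) ^ (k - j) * ((1 - x) / 2) ^ j)) / M := by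
    intro x
    simp only [hQ, eval_finsetSum, eval_mul, eval_C, eval_pow, eval_add, eval_sub, eval_X, eval_one,
      Finset.sum_div]
    refine Finset.sum_congr rfl fun j _ => ?_
    ring
  have hbd : ∀ x ∈ Set.Icc (-1 : ℝ) 1, |Q.eval x| ≤ 1 := by
    intro x hx
    rw [heval, abs_div, abs_of_pos hM, div_le_one hM]
    exact h _ ⟨by linarith [hx.2], by linarith [hx.1]⟩
  have h0 : Q.eval 1 = c 0 / M := by
    rw [heval, Finset.sum_eq_single 0]
    · simp
    · intro j _ hj
      simp [hj]
    · simp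
  have h1 : (derivative Q).eval 1 = (k * c 0 - c 1) / (2 * M) := by
    have hd : (derivative Q).eval 1 = ∑ j ∈ Finset.range (k + 1),
        c j / M * ((if j = 0 then (k : ℝ) / 2 else 0) + if j = 1 then -1 / 2 else 0) := by
      simp only [hQ, derivative_sum, derivative_C_mul, eval_finsetSum]
      refine Finset.sum_congr rfl fun j _ => ?_
      rw [eval_mul, eval_C]
      congr 1
      rcases j with _ | _ | j <;> simp [derivative_pow] <;> ring
    rw [hd]
    simp only [mul_add, Finset.sum_add_distrib, mul_ite, mul_zero, Finset.sum_ite_eq']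
    rw [if_pos (by simp), if_pos (by simpa using Nat.pos_of_ne_zero (by omega : k ≠ 0))]
    field_simp
    ring
  have hup := two_mul_derivative_sub_le Q hdeg hbd
  have hlo := two_mul_derivative_sub_le (-Q) (by rwa [degree_neg]) (by simpa using hbd)
  rw [h0, h1] at hup
  rw [derivative_neg, eval_neg, eval_neg, h0, h1] at hlo
  have he : 2 * ((k * c 0 - c 1) / (2 * M)) - k * (c 0 / M) = -c 1 / M := by
    field_simp
    ring
  have he' : 2 * -((k * c 0 - c 1) / (2 * M)) - k * -(c 0 / M) = c 1 / M := by
    field_simp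
    ring
  rw [he, div_le_iff₀ hM] at hup
  rw [he', div_le_iff₀ hM] at hlo
  rw [abs_le]
  constructor <;> linarith

/-! ### A Bernstein inequality for the partial trace -/

theorem sum_star_pow_mul_pow {N : ℕ} {ω : ℂ} (hω : IsPrimitiveRoot ω N) {i j : ℕ} (hi : i < N)
    (hj : j < N) :
    ∑ r ∈ Finset.range N, star (ω ^ r) ^ i * (ω ^ r) ^ j = if i = j then (N : ℂ) else 0 := by
  have hnorm : star ω * ω = 1 := by
    have h1 : ‖ω‖ = 1 := hω.norm'_eq_one (by omega)
    have := Complex.conj_mul' ω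
    rw [h1] at this
    simpa using this
  have hterm : ∀ r, star (ω ^ r) ^ i * (ω ^ r) ^ j = (star ω ^ i * ω ^ j) ^ r := by
    intro r
    rw [star_pow, mul_pow, ← pow_mul, ← pow_mul, ← pow_mul, ← pow_mul, mul_comm r i, mul_comm r j]
  simp only [hterm]
  split_ifs with hij
  · subst hij
    simp only [← mul_pow, hnorm, one_pow, Finset.sum_const, Finset.card_range, nsmul_one]
  · have hne : star ω ^ i * ω ^ j ≠ 1 := by
      intro h
      apply hij
      refine hω.pow_inj hi hj ?_
      calc ω ^ i = ω ^ i * (star ω ^ i * ω ^ j) := by rw [h, mul_one]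
        _ = (star ω * ω) ^ i * ω ^ j := by ring
        _ = ω ^ j := by rw [hnorm, one_pow, one_mul]
    have hN : (star ω ^ i * ω ^ j) ^ N = 1 := by
      rw [mul_pow, ← pow_mul, ← pow_mul, mul_comm i, mul_comm j, pow_mul, pow_mul, ← star_pow,
        hω.pow_eq_one]
      simp
    rw [geom_sum_eq hne, hN, sub_self, zero_div]

/-- Averaging over the phases `ω^r` removes the off-diagonal terms of a product of two powers. -/
theorem sum_add_pow_mul_add_pow {k N : ℕ} {ω : ℂ} (hω : IsPrimitiveRoot ω N) (hk : k < N)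
    (A A' B B' : ℂ) :
    ∑ r ∈ Finset.range N, (A + star (ω ^ r) * A') ^ k * (B + ω ^ r * B') ^ k =
      N * ∑ j ∈ Finset.range (k + 1), (k.choose j : ℂ) ^ 2 * (A * B) ^ (k - j) * (A' * B') ^ j := by
  have h1 : ∀ r, (A + star (ω ^ r) * A') ^ k * (B + ω ^ r * B') ^ k =
      ∑ i ∈ Finset.range (k + 1), ∑ j ∈ Finset.range (k + 1),
        (k.choose i * k.choose j * A ^ (k - i) * A' ^ i * B ^ (k - j) * B' ^ j) *
          (star (ω ^ r) ^ i * (ω ^ r) ^ j) := by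
    intro r
    rw [add_comm A, add_comm B, add_pow, add_pow, Finset.sum_mul_sum]
    refine Finset.sum_congr rfl fun i _ => Finset.sum_congr rfl fun j _ => ?_
    rw [mul_pow, mul_pow]
    ring
  simp only [h1]
  rw [Finset.sum_comm, Finset.mul_sum]
  refine Finset.sum_congr rfl fun i hi => ?_
  rw [Finset.sum_comm]
  simp only [← Finset.mul_sum]
  have hi' := Finset.mem_range.1 hi
  rw [Finset.sum_congr rfl fun j hj => by
    rw [sum_star_pow_mul_pow hω (by omega) (by have := Finset.mem_range.1 hj; omega)]]
  simp only [mul_ite, mul_zero, Finset.sum_ite_eq]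
  rw [if_pos hi]
  ring

/-- The averages of a form over the circles `p x + q ω^r u`, for `u` in an orthonormal basis, as
polynomials in `p²` and `q²`. With `k = t + 1`, the coefficients of `p^{2(k-1)} q²` sum up to `k²`
times the form of the partial trace over one factor, and the one for `u = x` is `k²` times the form
itself. -/
theorem exists_slice_coeff {d t D N : ℕ} {ω : ℂ} (hω : IsPrimitiveRoot ω N) (hN : t + 1 < N)
    (x : EuclideanSpace ℂ (Fin d)) (y : EuclideanSpace ℂ (Fin D))
    (e : OrthonormalBasis (Fin d) ℂ (EuclideanSpace ℂ (Fin d))) (V : SymOp d (t + 1) D) :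
    ∃ C : Fin d → ℕ → ℂ,
      (∀ i (p q : ℝ), ∑ r ∈ Finset.range N, cform ((p : ℂ) • x + ((q : ℂ) * ω ^ r) • e i) y V =
        N * ∑ j ∈ Finset.range (t + 1 + 1), C i j * ((p ^ 2) ^ (t + 1 - j) * (q ^ 2) ^ j)) ∧
      ∑ i, C i 1 = (t + 1) ^ 2 * cform x y (trDown t V) ∧
      ∀ i, e i = x → C i 1 = (t + 1) ^ 2 * cform x y V := by
  induction span_pureOp d (t + 1) D V using Submodule.span_induction with
  | mem V hV =>
    obtain ⟨⟨⟨a, b⟩, ⟨w, w'⟩⟩, rfl⟩ := hV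
    refine ⟨fun i j => ((t + 1).choose j : ℂ) ^ 2 * (braket x b * braket a x) ^ (t + 1 - j) *
      (braket (e i) b * braket a (e i)) ^ j * (braket y w' * braket w y), ?_, ?_, ?_⟩
    · intro i p q
      have h := sum_add_pow_mul_add_pow hω hN (p * braket x b) (q * braket (e i) b)
        (p * braket a x) (q * braket a (e i))
      have hl : ∀ r, cform ((p : ℂ) • x + ((q : ℂ) * ω ^ r) • e i) y (pureOp (t + 1) a b w w') =
          (p * braket x b + star (ω ^ r) * (q * braket (e i) b)) ^ (t + 1) *
          (p * braket a x + ω ^ r * (q * braket a (e i))) ^ (t + 1) *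
          (braket y w' * braket w y) := by
        intro r
        rw [cform_pureOp]
        have h1 : braket ((p : ℂ) • x + ((q : ℂ) * ω ^ r) • e i) b =
            p * braket x b + star (ω ^ r) * (q * braket (e i) b) := by
          simp only [braket, inner_add_left, inner_smul_left, map_mul, Complex.conj_ofReal]
          rw [starRingEnd_apply]
          ring
        have h2 : braket a ((p : ℂ) • x + ((q : ℂ) * ω ^ r) • e i) =
            p * braket a x + ω ^ r * (q * braket a (e i)) := by
          simp only [braket, inner_add_right, inner_smul_right]
          ring
        rw [h1, h2, mul_pow]
      simp only [hl]
      rw [← Finset.sum_mul, h, mul_assoc, Finset.sum_mul]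
      congr 1
      refine Finset.sum_congr rfl fun j _ => ?_
      have h1 : (p : ℂ) * braket x b * (p * braket a x) =
          p ^ 2 * (braket x b * braket a x) := by ring
      have h2 : (q : ℂ) * braket (e i) b * (q * braket a (e i)) =
          q ^ 2 * (braket (e i) b * braket a (e i)) := by ring
      rw [h1, h2, mul_pow ((p : ℂ) ^ 2), mul_pow ((q : ℂ) ^ 2)]
      ring
    · rw [trDown_pureOp (Nat.le_succ t), map_smul, cform_pureOp, smul_eq_mul]
      have he : ∑ i, braket (e i) b * braket a (e i) = braket a b := by
        refine Eq.trans ?_ (e.sum_inner_mul_inner a b)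
        exact Finset.sum_congr rfl fun i _ => mul_comm _ _
      simp only [pow_one, ← Finset.sum_mul, ← Finset.mul_sum, he]
      simp
      ring
    · intro i hi
      simp only [cform_pureOp, hi]
      simp
      ring
  | zero => exact ⟨0, by simp, by simp [← trDownₗ_apply], by simp⟩
  | add V V' _ _ h h' =>
    obtain ⟨C, h1, h2, h3⟩ := h
    obtain ⟨C', h1', h2', h3'⟩ := h'
    refine ⟨C + C', fun i p q => ?_, ?_, fun i hi => ?_⟩
    · simp only [map_add, Finset.sum_add_distrib, h1, h1', Pi.add_apply, add_mul, mul_add]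
    · rw [← trDownₗ_apply, map_add, map_add, mul_add, trDownₗ_apply, trDownₗ_apply, ← h2, ← h2']
      simp [Finset.sum_add_distrib]
    · rw [map_add, mul_add, ← h3 i hi, ← h3' i hi]
      rfl
  | smul c V _ h =>
    obtain ⟨C, h1, h2, h3⟩ := h
    refine ⟨c • C, fun i p q => ?_, ?_, fun i hi => ?_⟩
    · simp only [map_smul, smul_eq_mul, ← Finset.mul_sum, h1, Pi.smul_apply, mul_assoc]
      ring
    · rw [← trDownₗ_apply, map_smul, map_smul, trDownₗ_apply, smul_eq_mul, mul_left_comm, ← h2]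
      simp [Finset.mul_sum]
    · rw [map_smul, smul_eq_mul, mul_left_comm, ← h3 i hi]
      rfl

/-- The partial trace over one factor enlarges the bound of a form on the unit spheres at most by
`d (2k-1) / k`, where `k = t + 1`. -/
theorem abs_form_trDown_le {d t D : ℕ} {V : SymOp d (t + 1) D} (hV : V.IsHermitian) {M : ℝ}
    (hM : 0 < M) (h : ∀ x y, ‖x‖ = 1 → ‖y‖ = 1 → |form V x y| ≤ M)
    {x : EuclideanSpace ℂ (Fin d)} {y : EuclideanSpace ℂ (Fin D)} (hx : ‖x‖ = 1) (hy : ‖y‖ = 1) :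
    (t + 1) * |form (trDown t V) x y| ≤ d * (2 * t + 1) * M := by
  have hd : 0 < d := by
    rcases Nat.eq_zero_or_pos d with rfl | hd
    · rw [Subsingleton.elim x 0, norm_zero] at hx
      exact absurd hx zero_ne_one
    · exact hd
  let i₀ : Fin d := ⟨0, hd⟩
  -- an orthonormal basis that contains `x`
  obtain ⟨e, he⟩ := Orthonormal.exists_orthonormalBasis_extension_of_card_eq (𝕜 := ℂ)
    (E := EuclideanSpace ℂ (Fin d)) (ι := Fin d) (by simp) (v := fun _ => x) (s := {i₀})
    (by
      constructor
      · intro i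
        exact hx
      · intro i j hij
        exact absurd (Subsingleton.elim i j) hij)
  have hei : e i₀ = x := he i₀ rfl
  obtain ⟨C, h1, h2, h3⟩ := exists_slice_coeff (Complex.isPrimitiveRoot_exp (t + 2) (by omega))
    (by omega : t + 1 < t + 2) x y e V
  set ω := Complex.exp (2 * Real.pi * Complex.I / (t + 2 : ℕ)) with hω
  have hωn : ‖ω‖ = 1 := (Complex.isPrimitiveRoot_exp (t + 2) (by omega)).norm'_eq_one (by omega)
  have hbound : ∀ i, |(C i 1).re| ≤ (t + 1) * (2 * t + 1) * M := by
    intro i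
    by_cases hi : i = i₀
    · have h4 : (C i 1).re = (t + 1) ^ 2 * form V x y := by
        rw [h3 i (by rw [hi, hei]), cform_eq_form hV]
        norm_cast
      rw [h4, abs_mul, abs_of_nonneg (by positivity)]
      refine mul_le_mul ?_ (h x y hx hy) (abs_nonneg _) (by positivity)
      nlinarith [(Nat.cast_nonneg t : (0 : ℝ) ≤ t)]
    · -- here `√(1-s) x + √s ω^r e_i` is a unit vector for all `s ∈ [0, 1]`
      have hperp : inner ℂ x (e i) = 0 := by
        rw [← hei]
        exact e.orthonormal.2 (Ne.symm hi)
      have := abs_coeff_one_le (k := t + 1) (by omega) (fun j => (C i j).re) hM ?_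
      · push_cast at this
        convert this using 2
        ring
      intro s hs
      have h5 := congrArg Complex.re (h1 i (√(1 - s)) (√s))
      simp only [cform_eq_form hV, ← Complex.ofReal_pow, Real.sq_sqrt hs.1,
        Real.sq_sqrt (sub_nonneg.2 hs.2)] at h5
      rw [← Complex.ofReal_sum, Complex.ofReal_re, ← Complex.ofReal_natCast,
        Complex.re_ofReal_mul, Complex.re_sum] at h5
      simp only [← Complex.ofReal_mul, Complex.re_mul_ofReal] at h5
      have h6 : |∑ r ∈ Finset.range (t + 2), form V
          (((√(1 - s) : ℝ) : ℂ) • x + (((√s : ℝ) : ℂ) * ω ^ r) • e i) y| ≤ (t + 2 : ℕ) * M := by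
        refine (Finset.abs_sum_le_sum_abs _ _).trans ?_
        refine (Finset.sum_le_card_nsmul _ _ M fun r _ => h _ _ ?_ hy).trans (by simp)
        have h7 := norm_add_sq_eq_norm_sq_add_norm_sq_of_inner_eq_zero
          (𝕜 := ℂ) (((√(1 - s) : ℝ) : ℂ) • x) ((((√s : ℝ) : ℂ) * ω ^ r) • e i)
          (by rw [inner_smul_left, inner_smul_right, hperp]; simp)
        rw [norm_smul, norm_smul, norm_mul, norm_pow, hωn, hx, e.norm_eq_one, Complex.norm_real,
          Complex.norm_real, Real.norm_of_nonneg (Real.sqrt_nonneg _),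
          Real.norm_of_nonneg (Real.sqrt_nonneg _)] at h7
        simp only [mul_one, one_pow, Real.mul_self_sqrt hs.1,
          Real.mul_self_sqrt (sub_nonneg.2 hs.2)] at h7
        rw [← sq_eq_sq₀ (norm_nonneg _) zero_le_one, sq, h7]
        ring
      rw [h5, abs_mul, Nat.abs_cast] at h6
      exact le_of_mul_le_mul_left h6 (by positivity)
  have h4 : ∑ i, (C i 1).re = (t + 1) ^ 2 * form (trDown t V) x y := by
    rw [← Complex.re_sum, h2, cform_eq_form (trDown_isHermitian hV t)]
    norm_cast
  have h5 : (t + 1) ^ 2 * |form (trDown t V) x y| ≤ d * ((t + 1) * (2 * t + 1) * M) := by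
    rw [← abs_of_nonneg (show (0 : ℝ) ≤ (t + 1) ^ 2 by positivity), ← abs_mul, ← h4]
    refine (Finset.abs_sum_le_sum_abs _ _).trans ?_
    refine (Finset.sum_le_card_nsmul _ _ _ fun i _ => hbound i).trans (by simp)
  refine le_of_mul_le_mul_left (a := (t + 1 : ℝ)) ?_ (by positivity)
  calc _ = (t + 1) ^ 2 * |form (trDown t V) x y| := by ring
    _ ≤ _ := h5
    _ = _ := by ring

/-- The iterated bound for `tr_{k → t}`. -/
theorem abs_form_trDown_le_prod {d k D : ℕ} {W : SymOp d k D} (hW : W.IsHermitian) {M : ℝ}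
    (hd : 0 < d) (hM : 0 < M) (h : ∀ x y, ‖x‖ = 1 → ‖y‖ = 1 → |form W x y| ≤ M) {t : ℕ}
    (htk : t ≤ k) {x : EuclideanSpace ℂ (Fin d)} {y : EuclideanSpace ℂ (Fin D)} (hx : ‖x‖ = 1)
    (hy : ‖y‖ = 1) :
    |form (trDown t W) x y| ≤ M * ∏ j ∈ Finset.Ico t k, ((d : ℝ) * (2 * j + 1) / (j + 1)) := by
  induction htk using Nat.decreasingInduction generalizing x y with
  | self => simpa [trDown_self] using h x y hx hy
  | of_succ t htk ih =>
    have hpos : 0 < M * ∏ j ∈ Finset.Ico (t + 1) k, ((d : ℝ) * (2 * j + 1) / (j + 1)) :=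
      mul_pos hM (Finset.prod_pos fun j _ => by positivity)
    have := abs_form_trDown_le (trDown_isHermitian hW (t + 1)) hpos
      (fun _ _ hx hy => ih hx hy) hx hy
    rw [trDown_trDown (Nat.le_succ t) htk, ← le_div_iff₀' (by positivity)] at this
    refine this.trans (le_of_eq ?_)
    rw [Finset.prod_eq_prod_Ico_succ_bot htk]
    field_simp

/-! ### Positivity of the form of `W̃` -/

/-- The absolute value of `d[n+k] q(n,k,t)`. -/
def absCoeff (d n k t : ℕ) : ℝ :=
  ((n + t).choose t : ℝ) * (k.choose t : ℝ) / (n.choose k : ℝ) * (dimSym d (n + t) : ℝ)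

theorem dimSym_mul_coeffQ {d n k t : ℕ} (hd : 0 < d) :
    (dimSym d (n + k) : ℝ) * coeffQ d n k t = (-1) ^ (t + k) * absCoeff d n k t := by
  have : (dimSym d (n + k) : ℝ) ≠ 0 := Nat.cast_ne_zero.2 (dimSym_pos hd _).ne'
  rw [coeffQ, absCoeff]
  field_simp

theorem absCoeff_nonneg (d n k t : ℕ) : 0 ≤ absCoeff d n k t := by
  unfold absCoeff
  positivity

theorem absCoeff_succ {d n k t : ℕ} (hd : 0 < d) (htk : t < k) :
    absCoeff d n k t * ((k - t) * (d + n + t)) = (t + 1) ^ 2 * absCoeff d n k (t + 1) := by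
  have h1 : ((n + (t + 1)).choose (t + 1) : ℝ) * (t + 1) = (n + t).choose t * (n + t + 1) := by
    have := Nat.add_one_mul_choose_eq (n + t) t
    rw [← add_assoc]
    rw [mul_comm] at this
    exact_mod_cast this.symm
  have h2 : (k.choose (t + 1) : ℝ) * (t + 1) = k.choose t * (k - t) := by
    have := Nat.choose_succ_right_eq k t
    rw [← Nat.cast_sub htk.le]
    exact_mod_cast this
  have h3 : (dimSym d (n + (t + 1)) : ℝ) * (n + t + 1) = dimSym d (n + t) * (d + n + t) := by
    have := dimSym_succ_mul hd (n + t)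
    rw [← add_assoc, add_assoc (d : ℝ)]
    exact_mod_cast this
  have hne : (n + t + 1 : ℝ) ≠ 0 := by positivity
  refine mul_right_cancel₀ hne ?_
  rw [absCoeff, absCoeff]
  calc _ = ((n + t).choose t * (n + t + 1)) * (k.choose t * (k - t)) / (n.choose k : ℝ) *
        ((dimSym d (n + t) : ℝ) * (d + n + t)) := by ring
    _ = _ := by
      rw [← h1, ← h2, ← h3]
      ring

/-- The quantity `d k (2k-1) / (n + d + k - 1)` whose exponential controls the contributions of all
the partial traces to `W̃`. -/
def growth (d n k : ℕ) : ℝ := (d : ℝ) * k * (2 * k - 1) / (d + n + k - 1)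

theorem growth_le {d n k t : ℕ} (hd : 0 < d) (htk : t < k) :
    (d : ℝ) * (t + 1) * (2 * t + 1) / (d + n + t) ≤ growth d n k := by
  have hd' : (1 : ℝ) ≤ d := by exact_mod_cast hd
  have htk' : (t : ℝ) + 1 ≤ k := by exact_mod_cast htk
  have hn : (0 : ℝ) ≤ n := Nat.cast_nonneg n
  have ht : (0 : ℝ) ≤ t := Nat.cast_nonneg t
  rw [growth, div_le_div_iff₀ (by linarith) (by linarith), mul_assoc, mul_assoc, mul_assoc,
    mul_assoc]
  refine mul_le_mul_of_nonneg_left ?_ (by linarith)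
  have h1 : (t + 1) * ((2 * t + 1) * (d + n - 1 : ℝ)) ≤ k * ((2 * k - 1) * (d + n - 1)) :=
    mul_le_mul htk' (mul_le_mul_of_nonneg_right (by linarith) (by linarith))
      (mul_nonneg (by linarith) (by linarith)) (by linarith)
  have h2 : (t + 1) * ((2 * t + 1) * (k : ℝ)) ≤ k * ((2 * k - 1) * (t + 1)) := by
    have : (2 * t + 1) * ((t + 1) * (k : ℝ)) ≤ (2 * k - 1) * ((t + 1) * k) :=
      mul_le_mul_of_nonneg_right (by linarith) (mul_nonneg (by linarith) (by linarith))
    linarith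
  calc _ = (t + 1) * ((2 * t + 1) * (d + n - 1 : ℝ)) + (t + 1) * ((2 * t + 1) * (k : ℝ)) := by ring
    _ ≤ _ := add_le_add h1 h2
    _ = _ := by ring

theorem growth_nonneg {d n k : ℕ} (hd : 0 < d) (hk : 0 < k) : 0 ≤ growth d n k :=
  (by positivity : (0 : ℝ) ≤ (d : ℝ) * ((0 : ℕ) + 1) * (2 * (0 : ℕ) + 1) / (d + n + (0 : ℕ))).trans
    (growth_le hd hk)

/-- Compared with the coefficient of `W` itself, the contribution of `tr_{k → t}` is at most the
term of index `k - t` of an exponential series. -/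
theorem absCoeff_mul_prod_le {d n k t : ℕ} (hd : 0 < d) (htk : t ≤ k) :
    absCoeff d n k t * ∏ j ∈ Finset.Ico t k, ((d : ℝ) * (2 * j + 1) / (j + 1)) ≤
      absCoeff d n k k * (growth d n k ^ (k - t) / (k - t).factorial) := by
  induction htk using Nat.decreasingInduction with
  | self => simp
  | of_succ t htk ih =>
    have hkt : (0 : ℝ) < k - t := sub_pos.2 (by exact_mod_cast htk)
    have hd' : (0 : ℝ) < d := by exact_mod_cast hd
    have hsub : k - t = k - (t + 1) + 1 := by omega
    have hfac : (((k - t).factorial : ℕ) : ℝ) = (k - t) * ((k - (t + 1)).factorial : ℕ) := by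
      rw [hsub, Nat.factorial_succ, ← hsub, Nat.cast_mul, Nat.cast_sub htk.le]
    have hrec : absCoeff d n k t =
        (t + 1) ^ 2 * absCoeff d n k (t + 1) / ((k - t) * (d + n + t)) := by
      rw [eq_div_iff (by positivity), absCoeff_succ hd htk]
    set B := ∏ j ∈ Finset.Ico (t + 1) k, ((d : ℝ) * (2 * j + 1) / (j + 1)) with hB
    have hB0 : 0 ≤ B := Finset.prod_nonneg fun j _ => by positivity
    rw [Finset.prod_eq_prod_Ico_succ_bot htk, ← hB, hrec]
    calc _ = (absCoeff d n k (t + 1) * B) * (((d : ℝ) * (t + 1) * (2 * t + 1) / (d + n + t)) /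
          (k - t)) := by
          field_simp
      _ ≤ (absCoeff d n k k * (growth d n k ^ (k - (t + 1)) / (k - (t + 1)).factorial)) *
          (growth d n k / (k - t)) := by
          refine mul_le_mul ih (div_le_div_of_nonneg_right (growth_le hd htk) hkt.le)
            (by positivity) ?_
          exact (mul_nonneg (absCoeff_nonneg _ _ _ _) hB0).trans ih
      _ = _ := by
          rw [hfac, hsub, pow_succ]
          field_simp

/-- The lower bounds on `n` in terms of the exponential sum. -/
theorem sum_growth_le {d n k : ℕ} {m M : ℝ} (hd : 0 < d) (hm : 0 < m) (hM : 0 < M)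
    (hn : (d * k * (2 * k - 1) : ℝ) / Real.log (1 + m / M) - d - k + 1 ≤ (n : ℝ) ∨
      (k = 1 ∧ (d : ℝ) * (M / m) - d ≤ (n : ℝ))) :
    ∑ l ∈ Finset.range k, growth d n k ^ (l + 1) / (l + 1).factorial ≤ m / M := by
  have hd' : (1 : ℝ) ≤ d := by exact_mod_cast hd
  have hn0 : (0 : ℝ) ≤ n := Nat.cast_nonneg n
  have hmM : 0 < m / M := div_pos hm hM
  rcases Nat.eq_zero_or_pos k with rfl | hk
  · simpa using hmM.le
  have hk' : (1 : ℝ) ≤ k := by exact_mod_cast hk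
  rcases hn with hn | ⟨rfl, hn⟩
  · have hlog : 0 < Real.log (1 + m / M) := Real.log_pos (by linarith)
    have h1 : growth d n k ≤ Real.log (1 + m / M) := by
      rw [growth, div_le_iff₀ (by linarith), mul_comm (Real.log _), ← div_le_iff₀ hlog]
      linarith
    have h2 := Real.sum_le_exp_of_nonneg (growth_nonneg (n := n) hd hk) (k + 1)
    rw [Finset.sum_range_succ'] at h2
    have h3 := (Real.exp_le_exp.2 h1).trans_eq (Real.exp_log (by linarith))
    simp only [pow_zero, Nat.factorial_zero, Nat.cast_one, div_one] at h2
    linarith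
  · simp only [Finset.sum_range_one, zero_add, pow_one, Nat.factorial_one, Nat.cast_one, div_one,
      growth]
    rw [div_le_div_iff₀ (by linarith) hM]
    have h1 : d * M ≤ (d + n) * m := by
      rw [← div_le_iff₀ hm]
      calc (d * M / m : ℝ) = d * (M / m) := by ring
        _ ≤ _ := by linarith
    linarith

theorem form_smul_smul {d k D : ℕ} (W : SymOp d k D) (r s : ℝ) (x : EuclideanSpace ℂ (Fin d))
    (y : EuclideanSpace ℂ (Fin D)) :
    form W ((r : ℂ) • x) ((s : ℂ) • y) = (r ^ k * s) ^ 2 * form W x y := by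
  have h : prodVec k ((r : ℂ) • x) ((s : ℂ) • y) = ((r ^ k * s : ℝ) : ℂ) • prodVec k x y := by
    ext p
    simp [prodVec, Finset.prod_mul_distrib]
    ring
  rw [form, form, h, map_smul, Submodule.coe_smul, Submodule.coe_smul, braket, inner_smul_left,
    inner_smul_right, Complex.conj_ofReal, ← mul_assoc, ← Complex.ofReal_mul, Complex.re_ofReal_mul]
  ring

theorem form_tildeOp {d k D : ℕ} (n : ℕ) (hd : 0 < d) {W : SymOp d k D} (hW : W.IsHermitian)
    {x : EuclideanSpace ℂ (Fin d)} (y : EuclideanSpace ℂ (Fin D)) (hx : ‖x‖ = 1) :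
    form (tildeOp n W) x y = ∑ t ∈ Finset.range (k + 1),
      (-1) ^ (t + k) * absCoeff d n k t * form (trDown t W) x y := by
  have h := cform_tildeOp n W x y
  have hx' : braket x x = 1 := by
    rw [braket_self, hx]
    simp
  simp only [hx', one_pow, one_mul, cform_eq_form (tildeOp_isHermitian n hW),
    cform_eq_form (trDown_isHermitian hW _)] at h
  rw [← Complex.ofReal_inj, h]
  push_cast
  rw [Finset.mul_sum]
  refine Finset.sum_congr rfl fun t _ => ?_
  rw [← mul_assoc]
  congr 1
  exact_mod_cast dimSym_mul_coeffQ (n := n) (k := k) (t := t) hd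

/-- `p_{W̃}` is nonnegative. Relative to a common factor, the term of `W` itself in the alternating
sum for it is at least `m`, and the other terms together are at most `M ∑_{l=1}^{k} z^l / l!` in
absolute value, where `z` is `growth d n k`. -/
theorem form_tildeOp_nonneg {d k D n : ℕ} {W : SymOp d k D} (hW : W.IsHermitian) {m M : ℝ}
    (hm : 0 < m) (hd : 0 < d) (hD : 0 < D)
    (hlow : ∀ x y, ‖x‖ = 1 → ‖y‖ = 1 → m ≤ form W x y)
    (hup : ∀ x y, ‖x‖ = 1 → ‖y‖ = 1 → form W x y ≤ M)
    (hn : (d * k * (2 * k - 1) : ℝ) / Real.log (1 + m / M) - d - k + 1 ≤ (n : ℝ) ∨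
      (k = 1 ∧ (d : ℝ) * (M / m) - d ≤ (n : ℝ)))
    (x : EuclideanSpace ℂ (Fin d)) (y : EuclideanSpace ℂ (Fin D)) :
    0 ≤ form (tildeOp n W) x y := by
  -- by homogeneity, unit vectors suffice
  have hunit : ∀ {e : ℕ} (_ : 0 < e) (z : EuclideanSpace ℂ (Fin e)),
      ∃ u : EuclideanSpace ℂ (Fin e), ‖u‖ = 1 ∧ z = ((‖z‖ : ℝ) : ℂ) • u := by
    intro e he z
    by_cases hz : z = 0
    · exact ⟨EuclideanSpace.single ⟨0, he⟩ 1, by simp, by simp [hz]⟩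
    · have hz' : ‖z‖ ≠ 0 := norm_ne_zero_iff.2 hz
      refine ⟨((‖z‖⁻¹ : ℝ) : ℂ) • z, ?_, ?_⟩
      · rw [norm_smul, Complex.norm_real, norm_inv, norm_norm, inv_mul_cancel₀ hz']
      · rw [smul_smul, ← Complex.ofReal_mul, mul_inv_cancel₀ hz', Complex.ofReal_one, one_smul]
  obtain ⟨u, hu, hxu⟩ := hunit hd x
  obtain ⟨v, hv, hyv⟩ := hunit hD y
  rw [hxu, hyv, form_smul_smul]
  refine mul_nonneg (sq_nonneg _) ?_
  have hM : 0 < M := hm.trans_le ((hlow u v hu hv).trans (hup u v hu hv))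
  have habs : ∀ x y, ‖x‖ = 1 → ‖y‖ = 1 → |form W x y| ≤ M := fun x y hx hy => by
    rw [abs_of_nonneg (hm.le.trans (hlow x y hx hy))]
    exact hup x y hx hy
  rw [form_tildeOp n hd hW v hu, Finset.sum_range_succ, trDown_self, ← two_mul, pow_mul]
  have h1 : ∀ t ∈ Finset.range k, -(M * (absCoeff d n k k *
      (growth d n k ^ (k - 1 - t + 1) / (k - 1 - t + 1).factorial))) ≤
      (-1) ^ (t + k) * absCoeff d n k t * form (trDown t W) u v := by
    intro t ht
    have htk := Finset.mem_range.1 ht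
    refine (abs_le.1 ?_).1
    rw [abs_mul, abs_mul, abs_neg_one_pow, one_mul, abs_of_nonneg (absCoeff_nonneg _ _ _ _),
      show k - 1 - t + 1 = k - t by omega]
    calc _ ≤ absCoeff d n k t * (M * ∏ j ∈ Finset.Ico t k, ((d : ℝ) * (2 * j + 1) / (j + 1))) :=
          mul_le_mul_of_nonneg_left (abs_form_trDown_le_prod hW hd hM habs htk.le hu hv)
            (absCoeff_nonneg _ _ _ _)
      _ = M * (absCoeff d n k t *
            ∏ j ∈ Finset.Ico t k, ((d : ℝ) * (2 * j + 1) / (j + 1))) := by ring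
      _ ≤ _ := mul_le_mul_of_nonneg_left (absCoeff_mul_prod_le hd htk.le) hM.le
  have h2 := Finset.sum_le_sum h1
  rw [Finset.sum_neg_distrib, ← Finset.mul_sum, ← Finset.mul_sum,
    Finset.sum_range_reflect (fun l => growth d n k ^ (l + 1) / ((l + 1).factorial : ℝ))] at h2
  have h3 := sum_growth_le hd hm hM hn
  have h4 : M * (absCoeff d n k k * ∑ l ∈ Finset.range k,
      growth d n k ^ (l + 1) / ((l + 1).factorial : ℝ)) ≤ absCoeff d n k k * m := by
    calc _ ≤ M * (absCoeff d n k k * (m / M)) :=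
          mul_le_mul_of_nonneg_left (mul_le_mul_of_nonneg_left h3 (absCoeff_nonneg _ _ _ _)) hM.le
      _ = _ := by field_simp
  have h5 : absCoeff d n k k * m ≤ absCoeff d n k k * form W u v :=
    mul_le_mul_of_nonneg_left (hlow u v hu hv) (absCoeff_nonneg _ _ _ _)
  have h6 : ((-1 : ℝ) ^ 2) ^ k = 1 := by norm_num
  rw [h6, one_mul]
  linarith

/-! ### Gaussian moments -/

theorem integrable_norm_pow_mul_exp (n : ℕ) :
    Integrable fun z : ℂ => ‖z‖ ^ n * Real.exp (-‖z‖ ^ 2) := by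
  have h := Complex.integral_rpow_mul_exp_neg_rpow (p := 2) (q := n) (by norm_num)
    (by have : (0 : ℝ) ≤ n := n.cast_nonneg
        linarith)
  refine Integrable.of_integral_ne_zero ?_
  have h' : ∫ z : ℂ, ‖z‖ ^ n * Real.exp (-‖z‖ ^ 2) =
      2 * Real.pi / 2 * Real.Gamma ((n + 2) / 2) := by
    rw [← h]
    congr 1
    funext z
    norm_num
  rw [h']
  have := Real.Gamma_pos_of_pos (show (0 : ℝ) < (n + 2) / 2 by positivity)
  positivity

theorem integrable_pow_mul_conj_pow_mul_exp (a b : ℕ) :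
    Integrable fun z : ℂ => z ^ a * star z ^ b * (Real.exp (-‖z‖ ^ 2) : ℂ) := by
  refine (integrable_norm_pow_mul_exp (a + b)).mono' (by fun_prop) (Filter.Eventually.of_forall ?_)
  intro z
  rw [norm_mul, norm_mul, norm_pow, norm_pow, norm_star, Complex.norm_real,
    Real.norm_of_nonneg (Real.exp_pos _).le, pow_add]

/-- The moments of the Gaussian density `exp(-|z|²)` on `ℂ`. -/
theorem integral_pow_mul_conj_pow_mul_exp (a b : ℕ) :
    ∫ z : ℂ, z ^ a * star z ^ b * (Real.exp (-‖z‖ ^ 2) : ℂ) =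
      if a = b then (Real.pi * a.factorial : ℂ) else 0 := by
  split_ifs with hab
  · subst hab
    have h := Complex.integral_rpow_mul_exp_neg_rpow (p := 2) (q := (2 * a : ℕ)) (by norm_num)
      (by have : (0 : ℝ) ≤ (2 * a : ℕ) := Nat.cast_nonneg _
          linarith)
    have h1 : ∀ z : ℂ, z ^ a * star z ^ a * (Real.exp (-‖z‖ ^ 2) : ℂ) =
        ((‖z‖ ^ ((2 * a : ℕ) : ℝ) * Real.exp (-‖z‖ ^ (2 : ℝ)) : ℝ) : ℂ) := by
      intro z
      rw [← mul_pow, Real.rpow_natCast, Complex.ofReal_mul, pow_mul, Complex.ofReal_pow]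
      congr 2
      · simpa using Complex.mul_conj' z
      · norm_num
    simp only [h1]
    rw [integral_complex_ofReal, h]
    have h2 : (((2 * a : ℕ) : ℝ) + 2) / 2 = a + 1 := by
      push_cast
      ring
    rw [h2, Real.Gamma_nat_eq_factorial]
    push_cast
    ring
  · -- rotation by the angle `1` multiplies the integral by `exp(i(a-b)) ≠ 1`
    let c : Circle := Circle.exp 1
    have hrot := (rotation c).measurePreserving.integral_comp
      (rotation c).toHomeomorph.measurableEmbedding
      (fun z : ℂ => z ^ a * star z ^ b * (Real.exp (-‖z‖ ^ 2) : ℂ))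
    set I := ∫ z : ℂ, z ^ a * star z ^ b * (Real.exp (-‖z‖ ^ 2) : ℂ)
    have h2 : ∀ z : ℂ, (rotation c z) ^ a * star (rotation c z) ^ b *
        (Real.exp (-‖rotation c z‖ ^ 2) : ℂ) =
        ((c : ℂ) ^ a * star (c : ℂ) ^ b) * (z ^ a * star z ^ b * (Real.exp (-‖z‖ ^ 2) : ℂ)) := by
      intro z
      rw [LinearIsometryEquiv.norm_map, rotation_apply, star_mul', mul_pow, mul_pow]
      ring
    simp only [h2, integral_const_mul] at hrot
    change _ * I = I at hrot
    by_contra hI0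
    have h3 : (c : ℂ) ^ a * star (c : ℂ) ^ b = 1 := by
      have : ((c : ℂ) ^ a * star (c : ℂ) ^ b) * I = 1 * I := by rw [hrot, one_mul]
      exact mul_right_cancel₀ hI0 this
    have h4 : Complex.exp ((a - b : ℂ) * Complex.I) = 1 := by
      rw [← h3]
      simp only [c, Circle.coe_exp, Complex.ofReal_one, one_mul]
      rw [Complex.star_def, ← Complex.exp_conj, Complex.conj_I, ← Complex.exp_nat_mul,
        ← Complex.exp_nat_mul, ← Complex.exp_add]
      congr 1
      ring
    rw [Complex.exp_eq_one_iff] at h4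
    obtain ⟨n, hn⟩ := h4
    have h5 : ((a : ℝ) - b) = n * (2 * Real.pi) := by
      have : ((a - b : ℂ)) = n * (2 * Real.pi) := by
        refine mul_right_cancel₀ Complex.I_ne_zero ?_
        rw [hn]
        ring
      exact_mod_cast this
    have hn0 : n ≠ 0 := by
      rintro rfl
      apply hab
      have : (a : ℝ) - b = 0 := by simpa using h5
      exact_mod_cast sub_eq_zero.1 this
    -- otherwise `π` would be rational
    refine irrational_pi ⟨((a - b : ℤ) : ℚ) / (2 * n), ?_⟩
    push_cast
    rw [h5]
    have : (n : ℝ) ≠ 0 := by exact_mod_cast hn0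
    field_simp

/-- The Gaussian density on `ℂᵈ`. -/
def gauss (d : ℕ) (z : Fin d → ℂ) : ℝ := ∏ i, Real.exp (-‖z i‖ ^ 2)

theorem gauss_pos {d : ℕ} (z : Fin d → ℂ) : 0 < gauss d z :=
  Finset.prod_pos fun _ _ => Real.exp_pos _

theorem integrable_monomial_mul_gauss {d : ℕ} (a b : Fin d → ℕ) :
    Integrable fun z : Fin d → ℂ => ∏ i, (z i ^ a i * star (z i) ^ b i *
      (Real.exp (-‖z i‖ ^ 2) : ℂ)) :=
  Integrable.fintype_prod fun i => integrable_pow_mul_conj_pow_mul_exp (a i) (b i)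

theorem integral_monomial_mul_gauss {d : ℕ} (a b : Fin d → ℕ) :
    ∫ z : Fin d → ℂ, ∏ i, (z i ^ a i * star (z i) ^ b i * (Real.exp (-‖z i‖ ^ 2) : ℂ)) =
      if a = b then (Real.pi ^ d * ∏ i, ((a i).factorial : ℂ)) else 0 := by
  rw [integral_fintype_prod_volume_eq_prod
    (fun i z => z ^ a i * star z ^ b i * (Real.exp (-‖z‖ ^ 2) : ℂ))]
  simp only [integral_pow_mul_conj_pow_mul_exp]
  split_ifs with h
  · subst h
    simp [Finset.prod_mul_distrib]
  · obtain ⟨i, hi⟩ := Function.ne_iff.1 h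
    exact Finset.prod_eq_zero (Finset.mem_univ i) (if_neg hi)

theorem pow_mul_pow_mul_gauss {d : ℕ} (m : ℕ) (u v z : Fin d → ℂ) :
    (∑ i, u i * z i) ^ m * (∑ i, star (z i) * v i) ^ m * (gauss d z : ℂ) =
      ∑ a ∈ Finset.univ.piAntidiag m, ∑ b ∈ Finset.univ.piAntidiag m,
        ((Nat.multinomial Finset.univ a : ℂ) * Nat.multinomial Finset.univ b *
          ∏ i, (u i ^ a i * v i ^ b i)) *
        ∏ i, (z i ^ a i * star (z i) ^ b i * (Real.exp (-‖z i‖ ^ 2) : ℂ)) := by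
  rw [Finset.sum_pow_eq_sum_piAntidiag, Finset.sum_pow_eq_sum_piAntidiag, Finset.sum_mul_sum,
    Finset.sum_mul]
  refine Finset.sum_congr rfl fun a _ => ?_
  rw [Finset.sum_mul]
  refine Finset.sum_congr rfl fun b _ => ?_
  simp only [gauss, Complex.ofReal_prod, Finset.prod_mul_distrib, mul_pow]
  ring

/-- The Gaussian moments on `ℂᵈ`: `∫ ⟨u|z⟩^m ⟨z|v⟩^m exp(-‖z‖²) dz = π^d m! ⟨u|v⟩^m`. -/
theorem integral_pow_mul_pow_mul_gauss {d : ℕ} (m : ℕ) (u v : Fin d → ℂ) :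
    ∫ z : Fin d → ℂ, (∑ i, u i * z i) ^ m * (∑ i, star (z i) * v i) ^ m * (gauss d z : ℂ) =
      Real.pi ^ d * m.factorial * (∑ i, u i * v i) ^ m := by
  simp only [pow_mul_pow_mul_gauss]
  rw [integral_finsetSum _ fun a _ => integrable_finsetSum _ fun b _ =>
    (integrable_monomial_mul_gauss a b).const_mul _, Finset.sum_pow_eq_sum_piAntidiag,
    Finset.mul_sum]
  refine Finset.sum_congr rfl fun a ha => ?_
  rw [integral_finsetSum _ fun b _ => (integrable_monomial_mul_gauss a b).const_mul _]
  simp only [integral_const_mul, integral_monomial_mul_gauss, mul_ite, mul_zero]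
  rw [Finset.sum_ite_eq, if_pos ha]
  have h1 : (∏ i, ((a i).factorial : ℂ)) * Nat.multinomial Finset.univ a = m.factorial := by
    have h2 := Nat.multinomial_spec Finset.univ a
    rw [(Finset.mem_piAntidiag.1 ha).1] at h2
    exact_mod_cast h2
  rw [← h1]
  simp only [mul_pow]
  ring

/-! ### Finite cubature on the sphere -/

/-- Carathéodory's theorem turns the convex hull of a compact set into a continuous image of a
compact set. -/
theorem isCompact_convexHull_of_isCompact {E : Type*} [NormedAddCommGroup E] [NormedSpace ℝ E]
    [FiniteDimensional ℝ E] {K : Set E} (hK : IsCompact K) : IsCompact (convexHull ℝ K) := by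
  rcases K.eq_empty_or_nonempty with rfl | ⟨z₀, hz₀⟩
  · simp
  set n := Module.finrank ℝ E + 1 with hn
  have hc : IsCompact ((stdSimplex ℝ (Fin n)) ×ˢ (Set.univ.pi fun _ : Fin n => K)) :=
    (isCompact_stdSimplex ℝ (Fin n)).prod (isCompact_univ_pi fun _ => hK)
  have hf : Continuous fun q : (Fin n → ℝ) × (Fin n → E) => ∑ i, q.1 i • q.2 i := by fun_prop
  convert hc.image hf using 1
  ext x
  constructor
  · intro hx
    obtain ⟨ι, _, z, w, hz, hind, hw, hw1, rfl⟩ := eq_pos_convex_span_of_mem_convexHull hx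
    have hcard : Fintype.card ι ≤ Fintype.card (Fin n) := by
      rw [Fintype.card_fin]
      exact hind.card_le_finrank_succ.trans (Nat.succ_le_succ (Submodule.finrank_le _))
    obtain ⟨g⟩ := Function.Embedding.nonempty_of_card_le hcard
    refine ⟨(Function.extend g w 0, Function.extend g z fun _ => z₀), ⟨⟨fun i => ?_, ?_⟩, ?_⟩, ?_⟩
    · by_cases hi : ∃ a, g a = i
      · obtain ⟨a, rfl⟩ := hi
        simpa [g.injective.extend_apply] using (hw a).le
      · simp [Function.extend_apply' _ _ _ hi]
    · rw [← hw1]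
      refine (Fintype.sum_of_injective g g.injective _ _ (fun i hi => ?_) fun a => ?_).symm
      · simp [Function.extend_apply' _ _ _ hi]
      · simp [g.injective.extend_apply]
    · intro i _
      by_cases hi : ∃ a, g a = i
      · obtain ⟨a, rfl⟩ := hi
        simpa [g.injective.extend_apply] using hz ⟨a, rfl⟩
      · simpa [Function.extend_apply' _ _ _ hi] using hz₀
    · refine (Fintype.sum_of_injective g g.injective _ _ (fun i hi => ?_) fun a => ?_).symm
      · simp [Function.extend_apply' _ _ _ hi]
      · simp [g.injective.extend_apply]
  · rintro ⟨⟨w, z⟩, ⟨hw, hz⟩, rfl⟩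
    exact (convex_convexHull ℝ K).sum_mem (fun i _ => hw.1 i) hw.2
      fun i _ => subset_convexHull ℝ K (hz i trivial)

/-- The integral of a function with values in a compact subset `K` of a finite-dimensional space is
a finite combination of points of `K` with nonnegative weights. -/
theorem exists_sum_smul_eq_integral {α E : Type*} [MeasurableSpace α]
    [NormedAddCommGroup E] [NormedSpace ℝ E] [FiniteDimensional ℝ E] {K : Set E}
    (hK : IsCompact K) {ν : Measure α} [IsFiniteMeasure ν] [NeZero ν] {f : α → E}
    (hf : ∀ a, f a ∈ K) (hfi : Integrable f ν) :
    ∃ (N : ℕ) (c : Fin N → ℝ≥0) (z : Fin N → E), (∀ i, z i ∈ K) ∧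
      ∑ i, (c i : ℝ) • z i = ∫ a, f a ∂ν := by
  have h := (convex_convexHull ℝ K).average_mem
    (isCompact_convexHull_of_isCompact hK).isClosed
    (Filter.Eventually.of_forall fun a => subset_convexHull ℝ K (hf a)) hfi
  obtain ⟨ι, _, w, z, hw, -, hz, hsum⟩ := mem_convexHull_iff_exists_fintype.1 h
  let e := Fintype.equivFin ι
  refine ⟨Fintype.card ι, fun i => (ν.real Set.univ * w (e.symm i)).toNNReal,
    fun i => z (e.symm i), fun i => hz _, ?_⟩
  rw [← measure_smul_average, ← hsum, Finset.smul_sum,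
    ← e.symm.sum_comp (fun i => ν.real Set.univ • w i • z i)]
  refine Finset.sum_congr rfl fun i _ => ?_
  rw [Real.coe_toNNReal _ (mul_nonneg measureReal_nonneg (hw _)), smul_smul]

theorem integrable_norm_pow_mul_gauss {d : ℕ} (m : ℕ) :
    Integrable fun z : Fin d → ℂ => ‖WithLp.toLp 2 z‖ ^ (2 * m) * gauss d z := by
  have h : ∀ z : Fin d → ℂ, ((‖WithLp.toLp 2 z‖ ^ (2 * m) * gauss d z : ℝ) : ℂ) =
      ∑ a ∈ Finset.univ.piAntidiag m, (Nat.multinomial Finset.univ a : ℂ) *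
        ∏ i, (z i ^ a i * star (z i) ^ a i * (Real.exp (-‖z i‖ ^ 2) : ℂ)) := by
    intro z
    have h1 : (‖WithLp.toLp 2 z‖ ^ 2 : ℝ) = (∑ i, z i * star (z i) : ℂ) := by
      rw [EuclideanSpace.norm_sq_eq, Complex.ofReal_sum]
      refine Finset.sum_congr rfl fun i _ => ?_
      simpa using (Complex.mul_conj' (z i)).symm
    rw [pow_mul, Complex.ofReal_mul, Complex.ofReal_pow, h1, Finset.sum_pow_eq_sum_piAntidiag,
      Finset.sum_mul]
    refine Finset.sum_congr rfl fun a _ => ?_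
    simp only [gauss, Complex.ofReal_prod, Finset.prod_mul_distrib, mul_pow]
    ring
  have h2 : Integrable fun z : Fin d → ℂ =>
      ((‖WithLp.toLp 2 z‖ ^ (2 * m) * gauss d z : ℝ) : ℂ) := by
    simp only [h]
    exact integrable_finsetSum _ fun a _ => (integrable_monomial_mul_gauss a a).const_mul _
  exact h2.re

theorem continuous_gauss (d : ℕ) : Continuous (gauss d) := by
  unfold gauss
  fun_prop

theorem norm_tpow {d : ℕ} (m : ℕ) (x : EuclideanSpace ℂ (Fin d)) : ‖tpow m x‖ = ‖x‖ ^ m := by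
  have h : ((‖tpow m x‖ : ℂ)) ^ 2 = ((‖x‖ : ℂ) ^ 2) ^ m := by
    rw [← braket_self, ← braket_self, braket_tpow]
  have h' : ‖tpow m x‖ ^ 2 = (‖x‖ ^ m) ^ 2 := by
    rw [← pow_mul, mul_comm m, pow_mul]
    exact_mod_cast h
  exact (pow_left_inj₀ (norm_nonneg _) (by positivity) two_ne_zero).1 h'

theorem rankOne_tpow_smul {d : ℕ} (m : ℕ) (r : ℝ) (x : EuclideanSpace ℂ (Fin d)) :
    InnerProductSpace.rankOne ℂ (tpow m (r • x)) (tpow m (r • x)) =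
      r ^ (2 * m) • InnerProductSpace.rankOne ℂ (tpow m x) (tpow m x) := by
  have h : tpow m (r • x) = r ^ m • tpow m x := by
    ext i
    simp [tpow, Finset.prod_mul_distrib]
  rw [h, two_mul, pow_add, mul_smul]
  have hb : ∀ v, braket (r ^ m • tpow m x) v = (r : ℂ) ^ m * braket (tpow m x) v := by
    intro v
    simp only [braket_eq_sum, PiLp.smul_apply, Finset.mul_sum, Complex.real_smul, star_mul']
    refine Finset.sum_congr rfl fun i _ => ?_
    rw [Complex.star_def, Complex.conj_ofReal, Complex.ofReal_pow, mul_assoc]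
  ext v i
  change (braket (r ^ m • tpow m x) v • r ^ m • tpow m x : TPow d m) i =
    (r ^ m • r ^ m • braket (tpow m x) v • tpow m x : TPow d m) i
  rw [hb]
  simp only [PiLp.smul_apply, smul_eq_mul, Complex.real_smul, Complex.ofReal_pow]
  ring

/-- Integration against a finite combination of point masses. -/
theorem integral_sum_smul_dirac {α E : Type*} [MeasurableSpace α] [MeasurableSingletonClass α]
    [NormedAddCommGroup E] [NormedSpace ℝ E] [CompleteSpace E] {N : ℕ} (c : Fin N → ℝ≥0)
    (a : Fin N → α) (f : α → E) :
    ∫ x, f x ∂(∑ i, c i • Measure.dirac (a i)) = ∑ i, (c i : ℝ) • f (a i) := by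
  rw [integral_finsetSum_measure fun i _ => (integrable_dirac (by simp)).smul_measure_nnreal]
  simp only [integral_smul_nnreal_measure, integral_dirac]
  rfl

/-- For every `m` there is a finite cubature formula on the sphere with the moments of an
`m`-design. Radial projection turns the Gaussian measure with density `‖z‖^{2m} exp(-‖z‖²)` into a
multiple of an `m`-design, and Carathéodory's theorem makes it finite. -/
theorem exists_finite_design {d : ℕ} (hd : 0 < d) (m : ℕ) :
    ∃ (N : ℕ) (c : Fin N → ℝ≥0) (φ : Fin N → Metric.sphere (0 : EuclideanSpace ℂ (Fin d)) 1),
      HasMoments m (∑ i, c i • Measure.dirac (φ i)) := by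
  let F : EuclideanSpace ℂ (Fin d) → (TPow d m →L[ℂ] TPow d m) := fun x =>
    InnerProductSpace.rankOne ℂ (tpow m x) (tpow m x)
  have hF : Continuous F := continuous_rankOne_tpow m
  have hK : IsCompact (F '' Metric.sphere 0 1) := (isCompact_sphere _ _).image hF
  let e : EuclideanSpace ℂ (Fin d) := EuclideanSpace.single ⟨0, hd⟩ 1
  have he : ‖e‖ = 1 := by simp [e]
  -- `F` is homogeneous of degree `2 * m`, so it is determined by its values on the sphere; at
  -- `x = 0` any unit vector `y` will do, also for `m = 0`
  have hg : ∀ x, ∃ y, ‖y‖ = 1 ∧ F x = ‖x‖ ^ (2 * m) • F y := by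
    intro x
    by_cases hx : x = 0
    · refine ⟨e, he, ?_⟩
      have h := rankOne_tpow_smul m 0 e
      rw [zero_smul] at h
      rw [hx, norm_zero]
      exact h
    · refine ⟨‖x‖⁻¹ • x, by rw [norm_smul, norm_inv, norm_norm, inv_mul_cancel₀ (by simpa)], ?_⟩
      have h := rankOne_tpow_smul m ‖x‖ (‖x‖⁻¹ • x)
      rwa [smul_smul, mul_inv_cancel₀ (by simpa), one_smul] at h
  choose g hg1 hgF using hg
  let ρ : (Fin d → ℂ) → ℝ≥0 := fun z => (‖WithLp.toLp 2 z‖ ^ (2 * m) * gauss d z).toNNReal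
  have hρ : ∀ z, (ρ z : ℝ) = ‖WithLp.toLp 2 z‖ ^ (2 * m) * gauss d z := fun z =>
    Real.coe_toNNReal _ (mul_nonneg (by positivity) (gauss_pos z).le)
  have hρc : Continuous ρ := by
    have := continuous_gauss d
    have h : Continuous fun z : Fin d → ℂ => (WithLp.toLp 2 z : EuclideanSpace ℂ (Fin d)) := by
      fun_prop
    exact continuous_real_toNNReal.comp ((h.norm.pow _).mul this)
  have hρF : ∀ z : Fin d → ℂ, (ρ z : ℝ) • F (g (WithLp.toLp 2 z)) =
      gauss d z • F (WithLp.toLp 2 z) := by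
    intro z
    rw [hgF (WithLp.toLp 2 z), hρ, mul_comm, mul_smul]
  let ν : Measure (Fin d → ℂ) := volume.withDensity fun z => (ρ z : ENNReal)
  have hνf : IsFiniteMeasure ν := isFiniteMeasure_withDensity_ofReal
    (integrable_norm_pow_mul_gauss m).hasFiniteIntegral
  have hint : Integrable (fun z => gauss d z • F (WithLp.toLp 2 z)) := by
    refine (integrable_norm_pow_mul_gauss m).mono' ?_ (Filter.Eventually.of_forall fun z => ?_)
    · exact ((continuous_gauss d).smul (hF.comp (by fun_prop))).aestronglyMeasurable
    · rw [norm_smul, Real.norm_of_nonneg (gauss_pos z).le, InnerProductSpace.norm_rankOne,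
        norm_tpow, ← pow_add, two_mul, mul_comm]
  have hfi : Integrable (fun z => F (g (WithLp.toLp 2 z))) ν := by
    refine (integrable_withDensity_iff_integrable_coe_smul hρc.measurable).2 ?_
    simpa only [hρF] using hint
  have hval : ∀ u v : EuclideanSpace ℂ (Fin d),
      tpowElem m u v (∫ z, F (g (WithLp.toLp 2 z)) ∂ν) =
        Real.pi ^ d * m.factorial * braket u v ^ m := by
    intro u v
    have h1 : ∫ z, F (g (WithLp.toLp 2 z)) ∂ν = ∫ z, gauss d z • F (WithLp.toLp 2 z) := by
      rw [integral_withDensity_eq_integral_smul hρc.measurable]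
      congr 1
      funext z
      exact hρF z
    rw [h1, ← (tpowElem m u v).integral_comp_comm hint]
    have h2 := integral_pow_mul_pow_mul_gauss m (fun i => star (u i)) v
    rw [braket_eq_sum, ← h2]
    congr 1
    funext z
    have h3 : tpowElem m u v (gauss d z • F (WithLp.toLp 2 z)) =
        (gauss d z : ℂ) * tpowElem m u v (F (WithLp.toLp 2 z)) :=
      (tpowElem m u v).map_smul_of_tower (gauss d z) _
    rw [h3, tpowElem_rankOne, braket_eq_sum, braket_eq_sum, mul_comm]
  -- otherwise the moment for `u = v = e` would vanish
  have hν0 : NeZero ν := by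
    refine ⟨fun h0 => ?_⟩
    have h := hval e e
    have hb : braket e e = 1 := by
      rw [braket_self, he]
      simp
    rw [h0, integral_zero_measure, map_zero, hb, one_pow, mul_one] at h
    have : (Real.pi : ℂ) ^ d * m.factorial ≠ 0 := mul_ne_zero
      (pow_ne_zero _ (Complex.ofReal_ne_zero.2 Real.pi_ne_zero))
      (Nat.cast_ne_zero.2 m.factorial_ne_zero)
    exact this h.symm
  obtain ⟨N, c, A, hA, hsum⟩ := exists_sum_smul_eq_integral hK
    (fun z : Fin d → ℂ => ⟨g (WithLp.toLp 2 z), by simp [hg1], rfl⟩) hfi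
  choose φ hφ hφA using hA
  have hpos : 0 < Real.pi ^ d * m.factorial * dimSym d m := by
    have := dimSym_pos hd m
    positivity
  refine ⟨N, fun i => (Real.pi ^ d * m.factorial * dimSym d m).toNNReal⁻¹ * c i,
    fun i => ⟨φ i, hφ i⟩, fun u v => ?_⟩
  have h1 := hval u v
  rw [← hsum, map_sum] at h1
  have h2 : ∀ i, tpowElem m u v ((c i : ℝ) • A i) =
      (c i : ℂ) * (braket u (φ i) ^ m * braket (φ i) v ^ m) := by
    intro i
    rw [← tpowElem_rankOne, ← hφA i]
    exact (tpowElem m u v).map_smul_of_tower (c i : ℝ) _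
  rw [integral_sum_smul_dirac]
  simp only [h2] at h1
  simp only [NNReal.coe_mul, NNReal.coe_inv, Real.coe_toNNReal _ hpos.le, mul_smul]
  rw [← Finset.smul_sum]
  simp only [Complex.real_smul, Complex.ofReal_inv]
  have h3 : ((Real.pi ^ d * m.factorial * dimSym d m : ℝ) : ℂ) ≠ 0 :=
    Complex.ofReal_ne_zero.2 hpos.ne'
  refine mul_left_cancel₀ h3 ?_
  rw [mul_left_comm, mul_inv_cancel_left₀ h3]
  erw [h1]
  push_cast
  ring

/-! ### Sums of squares -/

theorem prodVec_eq_sum {d k D : ℕ} (x : EuclideanSpace ℂ (Fin d)) (y : EuclideanSpace ℂ (Fin D)) :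
    prodVec k x y = ∑ a, y a • prodVec k x (EuclideanSpace.single a 1) := by
  ext p
  simp only [Submodule.coe_sum, Submodule.coe_smul, WithLp.ofLp_sum, Finset.sum_apply,
    PiLp.smul_apply, smul_eq_mul, prodVec]
  rw [Finset.sum_eq_single p.2]
  · simp [mul_comm]
  · intro a _ ha
    simp [Ne.symm ha]
  · simp

open scoped ComplexOrder in
/-- For fixed `x`, a nonnegative form is a sum of squares of linear forms in `y`: its matrix is
positive semidefinite. -/
theorem exists_form_eq_sum_norm_sq {d k D : ℕ} {W : SymOp d k D} (hW : W.IsHermitian)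
    (x : EuclideanSpace ℂ (Fin d)) (h : ∀ y, 0 ≤ form W x y) :
    ∃ w : Fin D → EuclideanSpace ℂ (Fin D), ∀ y, form W x y = ∑ a, ‖braket (w a) y‖ ^ 2 := by
  let b : Fin D → symD d k D := fun a => prodVec k x (EuclideanSpace.single a 1)
  let T : Matrix (Fin D) (Fin D) ℂ :=
    Matrix.of fun a c => braket (b a : TPowD d k D) (W (b c) : TPowD d k D)
  have hT : ∀ y : Fin D → ℂ, star y ⬝ᵥ T.mulVec y = (form W x (WithLp.toLp 2 y) : ℂ) := by
    intro y
    rw [coe_form hW, prodVec_eq_sum, map_sum, Submodule.coe_sum, Submodule.coe_sum, braket,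
      sum_inner]
    refine Finset.sum_congr rfl fun a _ => ?_
    rw [inner_sum, Matrix.mulVec, dotProduct, Finset.mul_sum]
    refine Finset.sum_congr rfl fun c _ => ?_
    rw [map_smul, Submodule.coe_smul, Submodule.coe_smul, inner_smul_left, inner_smul_right]
    simp only [T, b, Matrix.of_apply, Pi.star_apply, Complex.star_def]
    ring
  have hpos : T.PosSemidef := by
    refine Matrix.PosSemidef.of_dotProduct_mulVec_nonneg ?_ fun y => ?_
    · ext a c
      rw [Matrix.conjTranspose_apply]
      simp only [T, Matrix.of_apply]
      rw [star_braket]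
      exact hW (b a) (b c)
    · rw [hT]
      exact_mod_cast h _
  obtain ⟨B, hB⟩ : ∃ B : Matrix (Fin D) (Fin D) ℂ, T = star B * B := by
    open scoped MatrixOrder Matrix.Norms.L2Operator in
    exact CStarAlgebra.nonneg_iff_eq_star_mul_self.1 hpos.nonneg
  refine ⟨fun a => WithLp.toLp 2 fun c => star (B a c), fun y => ?_⟩
  have h1 := hT y
  rw [hB, Matrix.star_eq_conjTranspose, ← Matrix.mulVec_mulVec, Matrix.dotProduct_mulVec,
    ← Matrix.star_mulVec] at h1
  have h2 : ((form W x y : ℝ) : ℂ) =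
      ((∑ a, ‖braket (WithLp.toLp 2 fun c => star (B a c)) y‖ ^ 2 : ℝ) : ℂ) := by
    refine h1.symm.trans ?_
    rw [Complex.ofReal_sum, dotProduct]
    refine Finset.sum_congr rfl fun a _ => ?_
    rw [braket_eq_sum, Pi.star_apply, Complex.star_def, mul_comm, Complex.mul_conj',
      Complex.ofReal_pow]
    simp [Matrix.mulVec, dotProduct]
  exact_mod_cast h2

theorem braket_ofReal_smul {ι : Type} [Fintype ι] (r : ℝ) (x y : EuclideanSpace ℂ ι) :
    braket ((r : ℂ) • x) y = r * braket x y := by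
  rw [braket, inner_smul_left, Complex.conj_ofReal]

theorem pos_of_formMin_pos {d k D : ℕ} {W : SymOp d k D} (h : 0 < formMin W) : 0 < d ∧ 0 < D := by
  obtain ⟨r, x, y, hx, hy, -⟩ : (formValues W).Nonempty := by
    by_contra hne
    -- the infimum of the empty set is `0`
    rw [formMin, Set.not_nonempty_iff_eq_empty.1 hne, Real.sInf_empty] at h
    exact lt_irrefl _ h
  constructor
  · refine Nat.pos_of_ne_zero ?_
    rintro rfl
    simp [Subsingleton.elim x 0] at hx
  · refine Nat.pos_of_ne_zero ?_
    rintro rfl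
    simp [Subsingleton.elim y 0] at hy

end

end PSSC

open PSSC
theorem theorem3p1 (d k D n : ℕ) (W : SymOp d k D) (hW : W.IsHermitian)
    (hm : 0 < formMin W) (hkn : k ≤ n)
    (hn : (d * k * (2 * k - 1) : ℝ) / Real.log (1 + formMin W / formMax W) - d - k + 1 ≤ (n : ℝ) ∨
      (k = 1 ∧ (d : ℝ) * (formMax W / formMin W) - d ≤ (n : ℝ))) :
    (tildeOp n W).IsHermitian ∧
    (∀ (φ : EuclideanSpace ℂ (Fin d)) (y : EuclideanSpace ℂ (Fin D)),
      0 ≤ form (tildeOp n W) φ y) ∧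
    (∀ μ : Measure (Metric.sphere (0 : EuclideanSpace ℂ (Fin d)) 1),
      IsSphericalDesign d (n + k) μ →
      ∀ (x : EuclideanSpace ℂ (Fin d)) (y : EuclideanSpace ℂ (Fin D)),
        ‖x‖ ^ (2 * (n - k)) * form W x y =
          ∫ φ, form (tildeOp n W) (φ : EuclideanSpace ℂ (Fin d)) y *
            ‖braket (φ : EuclideanSpace ℂ (Fin d)) x‖ ^ (2 * n) ∂μ) ∧
    (∃ (N : ℕ) (φ : Fin N → EuclideanSpace ℂ (Fin d)) (w : Fin N → EuclideanSpace ℂ (Fin D)),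
      ∀ (x : EuclideanSpace ℂ (Fin d)) (y : EuclideanSpace ℂ (Fin D)),
        ‖x‖ ^ (2 * (n - k)) * form W x y =
          ∑ j, ‖braket (φ j) x ^ n * braket (w j) y‖ ^ 2) := by
  obtain ⟨hd, hD⟩ := pos_of_formMin_pos hm
  obtain ⟨hmin, hmax⟩ := formMin_formMax_attained hd hD W
  have hpos : ∀ (φ : EuclideanSpace ℂ (Fin d)) (y : EuclideanSpace ℂ (Fin D)),
      0 ≤ form (tildeOp n W) φ y :=
    form_tildeOp_nonneg hW hm hd hD (fun x y hx hy => hmin.2 ⟨x, y, hx, hy, rfl⟩)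
      (fun x y hx hy => hmax.2 ⟨x, y, hx, hy, rfl⟩) hn
  refine ⟨tildeOp_isHermitian n hW, hpos, fun μ hμ => ?_, ?_⟩
  · have := hμ.finite
    exact hμ.hasMoments.integral_form_tildeOp hd hkn hW
  · obtain ⟨N, c, φ, hφ⟩ := exists_finite_design hd (n + k)
    choose w hw using fun i => exists_form_eq_sum_norm_sq (tildeOp_isHermitian n hW) (φ i)
      (hpos (φ i))
    let e : Fin N × Fin D ≃ Fin (N * D) := finProdFinEquiv
    -- the squares are indexed by pairs, and the cubature weights are absorbed into the `w_j`
    refine ⟨N * D, fun j => φ (e.symm j).1,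
      fun j => ((Real.sqrt (c (e.symm j).1) : ℝ) : ℂ) • w (e.symm j).1 (e.symm j).2,
      fun x y => ?_⟩
    rw [hφ.integral_form_tildeOp hd hkn hW, integral_sum_smul_dirac,
      e.symm.sum_comp fun p => ‖braket (φ p.1 : EuclideanSpace ℂ (Fin d)) x ^ n *
        braket (((Real.sqrt (c p.1) : ℝ) : ℂ) • w p.1 p.2) y‖ ^ 2, Fintype.sum_prod_type]
    refine Finset.sum_congr rfl fun i _ => ?_
    rw [hw, smul_eq_mul, Finset.sum_mul, Finset.mul_sum]
    refine Finset.sum_congr rfl fun a _ => ?_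
    rw [braket_ofReal_smul, norm_mul, norm_mul, norm_pow, Complex.norm_real,
      Real.norm_of_nonneg (Real.sqrt_nonneg _), mul_pow, mul_pow,
      Real.sq_sqrt (c i).coe_nonneg]
    ring
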